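/- **Setting.** Let $\Omega\subset\mathbb R^2$ be a simply connected (bounded, open) polygonal domain lying on one side of its boundary, $\mathbf f\in[L^2(\Omega)]^2$, and let $(\mathbf u,p)\in[H^1_0(\Omega)]^2\times L^2_0(\Omega)$ satisfy $$(\nabla\mathbf u,\nabla\mathbf v)+(p,\operatorname{div}\mathbf v)+(q,\operatorname{div}\mathbf u)=(\mathbf f,\mathbf v)\qquad\text{for all }(\mathbf v,q)\in[H^1_0(\Omega)]^2\times L^2_0(\Omega),$$ where $(\cdot,\cdot)$ is the $L^2(\Omega)$ inner product and $L^2_0$ denotes mean value zero. Assume that $p$ is continuously differentiable up to the boundary, so that the interpolation below makes sense. Let $\mathcal T_h$ be a conforming triangulation of $\Omega$ into closed non-degenerate triangles, all of whose angles are at least $\vartheta>0$ (shape-regularity). For an integer $k\ge 0$, $\mathcal P_h^k(\Omega)$ is the space of functions in $L^2(\Omega)$ that coincide with a polynomial of degree at most $k$ on each $K\in\mathcal T_h$, and $P^k(K)$ is the space of functions that are such a polynomial on $K$ and zero on $\Omega\setminus K$. Let $\Sigma_{h,0}=\mathcal P_h^5(\Omega)\cap H_0^2(\Omega)$, where $H_0^2(\Omega)=\{\phi\in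 H^2(\Omega):\phi,\phi_x,\phi_y\in H_0^1(\Omega)\}$, let $\mathbf Z_{h,0}=\{(\phi_y,-\phi_x):\phi\in\Sigma_{h,0}\}$, and let $\mathbf u_h\in\mathbf Z_{h,0}$ satisfy $(\nabla\mathbf u_h,\nabla\mathbf v_h)=(\mathbf f,\mathbf v_h)$ for all $\mathbf v_h\in\mathbf Z_{h,0}$. Let $\Pi_hp\in\mathcal P^3_h(\Omega)$ be the Hermite interpolation of $p$: on every triangle it matches $p$ and $\nabla p$ at the three vertices and $p$ at the gravity center. For $K\in\mathcal T_h$ put $$\mathcal B(K)=\{\mathbf v\in[P^4(K)]^2:\mathbf v=\mathbf 0\text{ on }\partial K\},\qquad \mathcal N(K)=\{\operatorname{div}\mathbf v:\mathbf v\in\mathcal B(K)\}\subset P^3(K).$$ For a vertex $\mathbf V$ of $K$ let $\mathfrak s_{\mathbf VK}\in P^3(K)$ be the function with $\int_K\mathfrak s_{\mathbf VK}\,q=\frac{|K|}{100}q(\mathbf V)$ for all polynomials $q$ of degree at most $3$. Let $\mathcal S(K)$ be the span of the three functions $\mathfrak s_{\mathbf VK}$, and let $1^K$ be the function equal to $1$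 on $K$ and $0$ elsewhere. Put $\mathcal N_h=\bigoplus_K\mathcal N(K)$, $\mathcal S_h=\bigoplus_K\mathcal S(K)$, $\mathcal C_h=\bigoplus_K\langle 1^K\rangle$. **Lemma.** For every $\vartheta>0$ there is a constant $C>0$ depending only on $\vartheta$ (in particular, not on $h$) such that, for all data as above, the following hold. 1. For each $K\in\mathcal T_h$ there is a unique $p_h^K\in\mathcal N(K)$ with $$(p_h^K,\operatorname{div}\mathbf v_h)=(\mathbf f,\mathbf v_h)-(\nabla\mathbf u_h,\nabla\mathbf v_h)\qquad\text{for all }\mathbf v_h\in\mathcal B(K).$$ 2. There is a unique $\Pi_hp^{\mathcal N}\in\mathcal N_h$ such that $\Pi_hp=\Pi_hp^{\mathcal N}+\Pi_hp^{\mathcal S}+\Pi_hp^{\mathcal C}$ for some $\Pi_hp^{\mathcal S}\in\mathcal S_h$ and $\Pi_hp^{\mathcal C}\in\mathcal C_h$. 3. With $p_h^{\mathcal N}=\sum_{K\in\mathcal T_h}p_h^K$, $$\|\Pi_hp^{\mathcal N}-p_h^{\mathcal N}\|_{0,K}\le C\left(|\mathbf u-\mathbf u_h|_{1,K}+\|p-\Pi_hp\|_{0,K}\right)\qquad\text{for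 each }K\in\mathcal T_h.$$ -/

import Mathlib

open MeasureTheory Filter Topology
open scoped ContDiff

noncomputable section

namespace StokesFE

/-- The Euclidean plane. -/
abbrev Plane := EuclideanSpace ℝ (Fin 2)

/-! ### Domains and triangulations -/

/-- A simply connected (bounded, open) polygonal domain: its boundary is a finite union of line
segments and it lies on one side of its boundary only (no slits: `interior (closure Ω) = Ω`). -/
structure IsPolygonalDomain (Ω : Set Plane) : Prop where
  isOpen : IsOpen Ω
  isBounded : Bornology.IsBounded Ω
  simplyConnected : SimplyConnectedSpace Ω
  frontier_eq : ∃ S : Finset (Plane × Plane), frontier Ω = ⋃ e ∈ S, segment ℝ e.1 e.2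
  interior_closure : interior (closure Ω) = Ω

/-- The closed triangle with vertex set `K`. -/
def tri (K : Finset Plane) : Set Plane := convexHull ℝ (K : Set Plane)

/-- A conforming triangulation of `Ω`. A triangle is given by the set of its three vertices.
Two triangles meet in the convex hull of their common vertices, that is, two different triangles
are disjoint or share exactly a vertex or an edge. -/
structure IsTriangulation (Ω : Set Plane) (T : Finset (Finset Plane)) : Prop where
  card_eq : ∀ K ∈ T, K.card = 3
  nondegenerate : ∀ K ∈ T, AffineIndependent ℝ (fun V : K => (V : Plane))
  cover : ⋃ K ∈ T, tri K = closure Ω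
  conforming : ∀ K ∈ T, ∀ K' ∈ T,
    tri K ∩ tri K' = convexHull ℝ ((K : Set Plane) ∩ (K' : Set Plane))

/-- Every angle of every triangle is at least `ϑ`. A family of triangulations is shape-regular
if this holds for all its members with one `ϑ > 0`. -/
def MinAngle (ϑ : ℝ) (T : Finset (Finset Plane)) : Prop :=
  ∀ K ∈ T, ∀ a ∈ K, ∀ b ∈ K, ∀ c ∈ K, a ≠ b → b ≠ c → a ≠ c →
    ϑ ≤ EuclideanGeometry.angle a b c

/-! ### Sobolev spaces through weak derivatives -/

/-- `v ∈ L²(Ω)`. -/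
def MemL2 (Ω : Set Plane) (v : Plane → ℝ) : Prop := MemLp v 2 (volume.restrict Ω)

/-- `q ∈ L²₀(Ω)`: square integrable with vanishing integral. -/
def MemL20 (Ω : Set Plane) (q : Plane → ℝ) : Prop := MemL2 Ω q ∧ ∫ x in Ω, q x = 0

/-- `φ ∈ C_c^∞(Ω)`. -/
def IsTest (Ω : Set Plane) (φ : Plane → ℝ) : Prop :=
  ContDiff ℝ ∞ φ ∧ HasCompactSupport φ ∧ tsupport φ ⊆ Ω

/-- The classical partial derivative in the `i`-th coordinate. -/
def partialDeriv (i : Fin 2) (φ : Plane → ℝ) (x : Plane) : ℝ :=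
  fderiv ℝ φ x (EuclideanSpace.single i 1)

/-- `g ∈ L²(Ω)` is the weak `i`-th partial derivative of `v` on `Ω`. -/
def IsWeakPartial (Ω : Set Plane) (i : Fin 2) (v g : Plane → ℝ) : Prop :=
  MemL2 Ω g ∧ ∀ φ, IsTest Ω φ →
    ∫ x in Ω, v x * partialDeriv i φ x = - ∫ x in Ω, g x * φ x

/-- `v ∈ H¹(Ω)`. -/
def MemH1 (Ω : Set Plane) (v : Plane → ℝ) : Prop :=
  MemL2 Ω v ∧ ∀ i, ∃ g, IsWeakPartial Ω i v g

open Classical in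
/-- A representative of the (almost everywhere unique) weak `i`-th partial derivative on `Ω`. -/
def weakPartial (Ω : Set Plane) (i : Fin 2) (v : Plane → ℝ) : Plane → ℝ :=
  if h : ∃ g, IsWeakPartial Ω i v g then h.choose else 0

/-- `v ∈ H¹₀(Ω)`, the closure of `C_c^∞(Ω)` in `H¹(Ω)`. -/
def MemH10 (Ω : Set Plane) (v : Plane → ℝ) : Prop :=
  MemH1 Ω v ∧ ∃ φ : ℕ → Plane → ℝ, (∀ n, IsTest Ω (φ n)) ∧
    Tendsto (fun n => eLpNorm (v - φ n) 2 (volume.restrict Ω)) atTop (𝓝 0) ∧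
    ∀ i, Tendsto (fun n => eLpNorm (weakPartial Ω i v - partialDeriv i (φ n)) 2
      (volume.restrict Ω)) atTop (𝓝 0)

/-- `v ∈ H²(Ω)`. -/
def MemH2 (Ω : Set Plane) (v : Plane → ℝ) : Prop :=
  MemH1 Ω v ∧ ∀ i, MemH1 Ω (weakPartial Ω i v)

/-- `v ∈ H²₀(Ω)`: `v ∈ H²(Ω)`, and `v` and its first derivatives are in `H¹₀(Ω)`. -/
def MemH20 (Ω : Set Plane) (v : Plane → ℝ) : Prop :=
  MemH2 Ω v ∧ MemH10 Ω v ∧ ∀ i, MemH10 Ω (weakPartial Ω i v)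

/-- The divergence of a vector field on `Ω`. -/
def divergence (Ω : Set Plane) (v : Fin 2 → Plane → ℝ) (x : Plane) : ℝ :=
  ∑ i, weakPartial Ω i (v i) x

/-- The inner product `(p, q)` of `L²(Ω)`. -/
def ip (Ω : Set Plane) (p q : Plane → ℝ) : ℝ := ∫ x in Ω, p x * q x

/-- The inner product `(f, v)` of `[L²(Ω)]²`. -/
def ipVec (Ω : Set Plane) (f v : Fin 2 → Plane → ℝ) : ℝ := ∑ i, ip Ω (f i) (v i)

/-- `(∇u, ∇v)` on `Ω`. -/
def ipGrad (Ω : Set Plane) (u v : Fin 2 → Plane → ℝ) : ℝ :=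
  ∑ i, ∑ j, ip Ω (weakPartial Ω j (u i)) (weakPartial Ω j (v i))

/-- The norm `‖q‖_{0,S}` of `L²(S)`. -/
def normL2 (S : Set Plane) (q : Plane → ℝ) : ℝ := Real.sqrt (∫ x in S, q x ^ 2)

/-- The seminorm `|w|_{1,S}` on a subset `S` of the closure of `Ω`, for a field `w` on `Ω`. -/
def seminormH1 (Ω S : Set Plane) (w : Fin 2 → Plane → ℝ) : ℝ :=
  Real.sqrt (∑ i, ∑ j, ∫ x in S, weakPartial Ω j (w i) x ^ 2)

/-- `(u, p) ∈ [H¹₀(Ω)]² × L²₀(Ω)` solves the incompressible Stokes equation with body force `f`. -/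
def IsStokesSolution (Ω : Set Plane) (f u : Fin 2 → Plane → ℝ) (p : Plane → ℝ) : Prop :=
  (∀ i, MemH10 Ω (u i)) ∧ MemL20 Ω p ∧
    ∀ (v : Fin 2 → Plane → ℝ) (q : Plane → ℝ), (∀ i, MemH10 Ω (v i)) → MemL20 Ω q →
      ipGrad Ω u v + ip Ω p (divergence Ω v) + ip Ω q (divergence Ω u) = ipVec Ω f v

/-! ### Piecewise polynomials and the discrete velocity -/

/-- The value of a polynomial in two variables at a point of the plane. -/
def evalAt (P : MvPolynomial (Fin 2) ℝ) (x : Plane) : ℝ := MvPolynomial.eval (fun i => x i) P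

/-- `v` is a piecewise polynomial of degree at most `k` (in the sense of `L²(Ω)`). -/
def IsPiecewisePoly (T : Finset (Finset Plane)) (k : ℕ) (v : Plane → ℝ) : Prop :=
  ∀ K ∈ T, ∃ P : MvPolynomial (Fin 2) ℝ, P.totalDegree ≤ k ∧
    ∀ᵐ x ∂(volume.restrict (tri K)), v x = evalAt P x

/-- The velocity space: the fields `(φ_y, -φ_x)`, where `φ ∈ H²₀(Ω)` is a piecewise polynomial of
degree at most five. -/
def velocitySpace (Ω : Set Plane) (T : Finset (Finset Plane)) : Set (Fin 2 → Plane → ℝ) :=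
  {w | ∃ φ : Plane → ℝ, IsPiecewisePoly T 5 φ ∧ MemH20 Ω φ ∧
    w 0 =ᵐ[volume.restrict Ω] weakPartial Ω 1 φ ∧
    w 1 =ᵐ[volume.restrict Ω] -weakPartial Ω 0 φ}

/-- `uh` is the discrete velocity. -/
def IsDiscreteVelocity (Ω : Set Plane) (T : Finset (Finset Plane))
    (f uh : Fin 2 → Plane → ℝ) : Prop :=
  uh ∈ velocitySpace Ω T ∧ ∀ v ∈ velocitySpace Ω T, ipGrad Ω uh v = ipVec Ω f v

/-! ### Local spaces on a triangle -/

/-- `P^k(K)`: the functions that are a polynomial of degree at most `k` on the triangle and zero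
elsewhere. -/
def localPoly (k : ℕ) (K : Finset Plane) : Set (Plane → ℝ) :=
  {q | ∃ P : MvPolynomial (Fin 2) ℝ, P.totalDegree ≤ k ∧ q = (tri K).indicator (evalAt P)}

/-- The bubble space `B(K)`: fields in `[P⁴(K)]²` that vanish on the boundary of the triangle. -/
def bubbleSpace (K : Finset Plane) : Set (Fin 2 → Plane → ℝ) :=
  {v | ∀ i, v i ∈ localPoly 4 K ∧ ∀ x ∈ frontier (tri K), v i x = 0}

/-- The space `N(K) = div B(K)` of non-sting functions, as a subset of `P³(K)`. -/
def nonStingSpace (Ω : Set Plane) (K : Finset Plane) : Set (Plane → ℝ) :=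
  {q | q ∈ localPoly 3 K ∧
    ∃ v ∈ bubbleSpace K, q =ᵐ[volume.restrict Ω] divergence Ω v}

/-- `s` is the sting function of the vertex `V` on `K`: it is in `P³(K)` and satisfies
`∫_K s q = |K| / 100 * q(V)` for all polynomials `q` of degree at most three. -/
def IsSting (K : Finset Plane) (V : Plane) (s : Plane → ℝ) : Prop :=
  s ∈ localPoly 3 K ∧ ∀ P : MvPolynomial (Fin 2) ℝ, P.totalDegree ≤ 3 →
    ∫ x in tri K, s x * evalAt P x = volume.real (tri K) / 100 * evalAt P V

/-- `S(K)`: the span of the three sting functions on `K`. -/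
def stingSpace (K : Finset Plane) : Set (Plane → ℝ) :=
  (Submodule.span ℝ {s | ∃ V ∈ K, IsSting K V s} : Submodule ℝ (Plane → ℝ))

/-- The constants on `K`, extended by zero. -/
def constSpace (K : Finset Plane) : Set (Plane → ℝ) :=
  (Submodule.span ℝ {(tri K).indicator (fun _ => (1 : ℝ))} : Submodule ℝ (Plane → ℝ))

/-- The sum over all triangles of a family of local spaces. -/
def sumSpace (T : Finset (Finset Plane)) (X : Finset Plane → Set (Plane → ℝ)) :
    Set (Plane → ℝ) :=
  {q | ∃ r : Finset Plane → Plane → ℝ, (∀ K ∈ T, r K ∈ X K) ∧ q = ∑ K ∈ T, r K}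

/-- `qN` is the non-sting component of `q` in the decomposition of the piecewise cubics into
non-sting, sting and piecewise constant functions. -/
def IsNonStingComponent (Ω : Set Plane) (T : Finset (Finset Plane)) (q qN : Plane → ℝ) : Prop :=
  qN ∈ sumSpace T (nonStingSpace Ω) ∧
    ∃ qS ∈ sumSpace T stingSpace, ∃ qC ∈ sumSpace T constSpace,
      q =ᵐ[volume.restrict Ω] qN + qS + qC

/-! ### Interpolation of the pressure -/

/-- `p` is continuously differentiable up to the boundary of `Ω`, with gradient `g`. -/
def IsC1UpToBoundary (Ω : Set Plane) (p : Plane → ℝ) (g : Plane → Plane) : Prop :=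
  ContinuousOn p (closure Ω) ∧ ContinuousOn g (closure Ω) ∧ ∀ x ∈ Ω, HasGradientAt p (g x) x

/-- `r` is the piecewise cubic Hermite interpolation of `p`, whose gradient is `g`: on every
triangle it matches the values and gradients at the vertices and the value at the gravity
center. -/
def IsHermiteInterpolation (T : Finset (Finset Plane)) (p : Plane → ℝ) (g : Plane → Plane)
    (r : Plane → ℝ) : Prop :=
  ∀ K ∈ T, ∃ P : MvPolynomial (Fin 2) ℝ, P.totalDegree ≤ 3 ∧
    (∀ᵐ x ∂(volume.restrict (tri K)), r x = evalAt P x) ∧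
    (∀ V ∈ K, evalAt P V = p V ∧ ∀ i, evalAt (MvPolynomial.pderiv i P) V = g V i) ∧
    evalAt P ((1 / 3 : ℝ) • ∑ V ∈ K, V) = p ((1 / 3 : ℝ) • ∑ V ∈ K, V)

/-- `q` is the local non-sting pressure on `K`: `q ∈ N(K)` and
`(q, div v) = (f, v) - (∇uh, ∇v)` for all `v ∈ B(K)`. -/
def IsLocalPressure (Ω : Set Plane) (f uh : Fin 2 → Plane → ℝ) (K : Finset Plane)
    (q : Plane → ℝ) : Prop :=
  q ∈ nonStingSpace Ω K ∧ ∀ v ∈ bubbleSpace K,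
    ip Ω q (divergence Ω v) = ipVec Ω f v - ipGrad Ω uh v

end StokesFE

end

/-!
Everything happens on one triangle `K` at a time. A bubble field on the reference triangle is
`x y (1 - x - y)` times an affine field, and comparison of coefficients shows that its divergence
determines it (`eq_zero_of_divPoly_eq_zero_refTri`); the Piola transform carries this over to `K`.
So the `L²` inner product of divergences is definite on the finite-dimensional space of bubble
fields and represents every functional on it. This yields the local pressure
(`existsUnique_isLocalPressure`); no compatibility condition on the discrete velocity is needed.

For the decomposition, the divergence of a bubble field vanishes at the vertices and has mean value
zero, so it is orthogonal to the sting functions and to the constants. Conversely a cubic that is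
orthogonal to these is the divergence of a bubble field (`IsParam.exists_divPoly_eq`): the cubics
that vanish at the vertices are spanned by such divergences and one function of positive mean value,
the cubic bubble. Orthogonal projection then gives `IsParam.exists_decomposition`, and orthogonality
gives uniqueness.

For the estimate, the error on `K` is the divergence of a bubble field `D`. Extended by zero, `D` is
in `H¹₀(Ω)` (`memH10_indicator`): truncating its components near their zero sets gives test
functions. Testing the Stokes equation with `D` expresses the square of the norm of the error by
`p - Π_h p` and `∇(u - u_h)` (`integral_divPoly_sq_eq`), and Cauchy-Schwarz reduces the claim to
`‖∇D‖ ≤ C ‖div D‖`. On the reference triangle this holds by finite-dimensionality; on `K` the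
constant picks up the condition number of the affine map from the reference triangle
(`IsParam.gradient_le`), which the law of sines bounds in terms of the minimal angle
(`exists_isParam`).
-/

noncomputable section

namespace StokesFE

open MvPolynomial

/-! ### Polynomials as smooth functions on the plane -/

@[simp] theorem evalAt_add (P Q : MvPolynomial (Fin 2) ℝ) (x : Plane) :
    evalAt (P + Q) x = evalAt P x + evalAt Q x := by simp [evalAt]

@[simp] theorem evalAt_sub (P Q : MvPolynomial (Fin 2) ℝ) (x : Plane) :
    evalAt (P - Q) x = evalAt P x - evalAt Q x := by simp [evalAt]

@[simp] theorem evalAt_mul (P Q : MvPolynomial (Fin 2) ℝ) (x : Plane) :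
    evalAt (P * Q) x = evalAt P x * evalAt Q x := by simp [evalAt]

@[simp] theorem evalAt_neg (P : MvPolynomial (Fin 2) ℝ) (x : Plane) :
    evalAt (-P) x = -evalAt P x := by simp [evalAt]

@[simp] theorem evalAt_smul (c : ℝ) (P : MvPolynomial (Fin 2) ℝ) (x : Plane) :
    evalAt (c • P) x = c * evalAt P x := by simp [evalAt, smul_eval]

@[simp] theorem evalAt_C (c : ℝ) (x : Plane) : evalAt (C c) x = c := by simp [evalAt]

@[simp] theorem evalAt_X (i : Fin 2) (x : Plane) : evalAt (X i) x = x i := by simp [evalAt]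

@[simp] theorem evalAt_zero (x : Plane) : evalAt 0 x = 0 := by simp [evalAt]

@[simp] theorem evalAt_one (x : Plane) : evalAt 1 x = 1 := by simp [evalAt]

theorem hasFDerivAt_evalAt (P : MvPolynomial (Fin 2) ℝ) (x : Plane) :
    HasFDerivAt (evalAt P)
      (∑ i, evalAt (pderiv i P) x • (EuclideanSpace.proj i : Plane →L[ℝ] ℝ)) x := by
  induction P using MvPolynomial.induction_on with
  | C a =>
    have : evalAt (C a) = fun _ => a := by ext; simp
    simpa [this] using hasFDerivAt_const a x
  | add p q hp hq =>
    have : evalAt (p + q) = evalAt p + evalAt q := by ext; simp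
    rw [this]
    refine (hp.add hq).congr_fderiv ?_
    simp [add_smul, Finset.sum_add_distrib]
  | mul_X p j hp =>
    have : evalAt (p * X j) = evalAt p * fun x : Plane => x j := by ext; simp
    rw [this]
    have hX : HasFDerivAt (fun x : Plane => x j) (EuclideanSpace.proj j : Plane →L[ℝ] ℝ) x :=
      (EuclideanSpace.proj j : Plane →L[ℝ] ℝ).hasFDerivAt
    refine (hp.mul hX).congr_fderiv ?_
    ext y
    fin_cases j <;> simp [pderiv_X, Pi.single_apply] <;> ring

theorem contDiff_evalAt (P : MvPolynomial (Fin 2) ℝ) {n : ℕ∞ω} : ContDiff ℝ n (evalAt P) := by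
  induction P using MvPolynomial.induction_on with
  | C a =>
    have : evalAt (C a) = fun _ => a := by ext; simp
    rw [this]; exact contDiff_const
  | add p q hp hq =>
    have : evalAt (p + q) = evalAt p + evalAt q := by ext; simp
    rw [this]; exact hp.add hq
  | mul_X p j hp =>
    have : evalAt (p * X j) = evalAt p * fun x : Plane => x j := by ext; simp
    rw [this]
    exact hp.mul (EuclideanSpace.proj j : Plane →L[ℝ] ℝ).contDiff

theorem continuous_evalAt (P : MvPolynomial (Fin 2) ℝ) : Continuous (evalAt P) :=
  (contDiff_evalAt (n := 0) P).continuous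

theorem fderiv_evalAt_single (P : MvPolynomial (Fin 2) ℝ) (x : Plane) (i : Fin 2) :
    fderiv ℝ (evalAt P) x (EuclideanSpace.single i 1) = evalAt (pderiv i P) x := by
  rw [(hasFDerivAt_evalAt P x).fderiv]
  fin_cases i <;> simp

/-- On every line, a polynomial either vanishes identically or has finitely many zeros; hence its
partial derivatives vanish almost everywhere on its zero set. -/
theorem ae_pderiv_eq_zero (P : MvPolynomial (Fin 2) ℝ) (i : Fin 2) :
    ∀ᵐ x : Plane, evalAt P x = 0 → evalAt (pderiv i P) x = 0 := by
  let s : Set Plane := {x | evalAt P x = 0 → evalAt (pderiv i P) x = 0}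
  have hs : MeasurableSet s := by
    have : s = {x | evalAt P x = 0}ᶜ ∪ {x | evalAt (pderiv i P) x = 0} := by
      ext x; simp only [s, Set.mem_ofPred_eq, Set.mem_union, Set.mem_compl_iff]; tauto
    rw [this]
    exact (measurableSet_eq_fun (continuous_evalAt P).measurable measurable_const).compl.union
      (measurableSet_eq_fun (continuous_evalAt _).measurable measurable_const)
  refine ae_mem_of_ae_add_linearMap_mem
    (L := LinearMap.toSpanSingleton ℝ Plane (EuclideanSpace.single i 1))
    (μ := (volume : Measure ℝ)) volume hs fun y => ?_
  -- the restriction of `P` to the line through `y` in direction `i`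
  let q : Polynomial ℝ := aeval (fun j => Polynomial.C (y j) +
    Polynomial.C ((EuclideanSpace.single i (1 : ℝ) : Plane) j) * Polynomial.X) P
  have hq : ∀ t : ℝ, q.eval t = evalAt P (y + t • EuclideanSpace.single i 1) := by
    intro t
    simp only [q, evalAt]
    rw [← Polynomial.coe_evalRingHom, aeval_def, MvPolynomial.hom_eval₂]
    rw [MvPolynomial.eval, MvPolynomial.coe_eval₂Hom]
    congr 1
    · ext; simp
    · ext j
      simp only [Polynomial.coe_evalRingHom]
      by_cases hj : j = i <;> simp [hj]
  have hd : ∀ t : ℝ, q.derivative.eval t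
      = evalAt (pderiv i P) (y + t • EuclideanSpace.single i 1) := by
    intro t
    have h1 := q.hasDerivAt t
    have h2 : HasDerivAt (fun t : ℝ => evalAt P (y + t • EuclideanSpace.single i (1 : ℝ)))
        (fderiv ℝ (evalAt P) (y + t • EuclideanSpace.single i 1)
          (EuclideanSpace.single i (1 : ℝ))) t := by
      have h3 : HasDerivAt (fun t : ℝ => y + t • (EuclideanSpace.single i (1 : ℝ) : Plane))
          (EuclideanSpace.single i (1 : ℝ)) t := by
        simpa using ((hasDerivAt_id t).smul_const
          (EuclideanSpace.single i (1 : ℝ) : Plane)).const_add y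
      exact (hasFDerivAt_evalAt P _).differentiableAt.hasFDerivAt.comp_hasDerivAt t h3
    rw [fderiv_evalAt_single] at h2
    rw [show (fun t => q.eval t) = _ from funext hq] at h1
    exact h1.unique h2
  change ∀ᵐ t : ℝ, evalAt P (y + t • EuclideanSpace.single i (1 : ℝ)) = 0 →
    evalAt (pderiv i P) (y + t • EuclideanSpace.single i (1 : ℝ)) = 0
  simp_rw [← hq, ← hd]
  by_cases h0 : q = 0
  · simp [h0]
  · have hfin : {t : ℝ | q.eval t = 0}.Finite := by
      refine q.roots.toFinset.finite_toSet.subset fun t ht => ?_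
      simpa [h0] using ht
    have := (hfin.countable.ae_notMem (volume : Measure ℝ))
    filter_upwards [this] with t ht ht'
    exact absurd ht' ht

/-! ### Truncation of a polynomial near its zero set -/

/-- A smooth function on the line that vanishes near `0` and equals the identity away from `0`. -/
def cutoff (t : ℝ) : ℝ := t * Real.smoothTransition (t ^ 2 - 1)

theorem contDiff_cutoff {n : ℕ∞} : ContDiff ℝ n cutoff :=
  contDiff_id.mul (Real.smoothTransition.contDiff.comp ((contDiff_id.pow 2).sub contDiff_const))

theorem abs_cutoff_le (t : ℝ) : |cutoff t| ≤ |t| := by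
  rw [cutoff, abs_mul, abs_of_nonneg (Real.smoothTransition.nonneg _)]
  exact mul_le_of_le_one_right (abs_nonneg t) (Real.smoothTransition.le_one _)

theorem cutoff_of_abs_le {t : ℝ} (ht : |t| ≤ 1) : cutoff t = 0 := by
  have : t ^ 2 ≤ 1 := by rw [← sq_abs]; exact pow_le_one₀ (abs_nonneg t) ht
  rw [cutoff, Real.smoothTransition.zero_of_nonpos (by linarith), mul_zero]

theorem cutoff_of_two_le {t : ℝ} (ht : 2 ≤ |t|) : cutoff t = t := by
  have : 4 ≤ t ^ 2 := by rw [← sq_abs]; nlinarith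
  rw [cutoff, Real.smoothTransition.one_of_one_le (by linarith), mul_one]

theorem deriv_cutoff_of_abs_lt {t : ℝ} (ht : |t| < 1) : deriv cutoff t = 0 := by
  have : cutoff =ᶠ[𝓝 t] fun _ => 0 := by
    filter_upwards [(isOpen_lt continuous_abs continuous_const).mem_nhds ht] with s hs
    exact cutoff_of_abs_le (le_of_lt hs)
  rw [this.deriv_eq, deriv_const]

theorem deriv_cutoff_of_two_lt {t : ℝ} (ht : 2 < |t|) : deriv cutoff t = 1 := by
  have : cutoff =ᶠ[𝓝 t] fun s => s := by
    filter_upwards [(isOpen_lt continuous_const continuous_abs).mem_nhds ht] with s hs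
    exact cutoff_of_two_le (le_of_lt hs)
  rw [this.deriv_eq, deriv_id'']

theorem exists_abs_deriv_cutoff_le : ∃ M : ℝ, ∀ t, |deriv cutoff t| ≤ M := by
  have hc : Continuous (deriv cutoff) :=
    (contDiff_cutoff (n := 1)).continuous_deriv le_rfl
  obtain ⟨M, hM⟩ := (isCompact_Icc (a := (-2 : ℝ)) (b := 2)).exists_bound_of_continuousOn
    hc.continuousOn
  refine ⟨max M 1, fun t => ?_⟩
  by_cases ht : |t| ≤ 2
  · exact (hM t (abs_le.mp ht)).trans (le_max_left _ _)
  · rw [deriv_cutoff_of_two_lt (not_le.mp ht)]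
    simp

/-- The truncations of `P`, restricted to `S`: they vanish near the zero set of `P`, and they
coincide with `P` on larger and larger parts of `S`. -/
def truncation (S : Set Plane) (P : MvPolynomial (Fin 2) ℝ) (n : ℕ) : Plane → ℝ :=
  S.indicator fun x => cutoff ((n + 1) * evalAt P x) / (n + 1)

section Truncation

variable {S : Set Plane} {P : MvPolynomial (Fin 2) ℝ}

theorem contDiff_cutoff_evalAt (P : MvPolynomial (Fin 2) ℝ) (n : ℕ) :
    ContDiff ℝ ∞ fun x => cutoff ((n + 1) * evalAt P x) / (n + 1) :=
  (contDiff_cutoff.comp (contDiff_const.mul (contDiff_evalAt P))).div_const _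

/-- Near a point, the truncation coincides with the composition of the cutoff and the polynomial
or with zero. -/
theorem truncation_eventuallyEq (hS : IsClosed S) (hP : ∀ x ∈ frontier S, evalAt P x = 0)
    (n : ℕ) (x : Plane) :
    (x ∈ interior S ∧ truncation S P n =ᶠ[𝓝 x]
      fun x => cutoff ((n + 1) * evalAt P x) / (n + 1)) ∨
    ((x ∈ S → |(n + 1) * evalAt P x| < 1) ∧ truncation S P n =ᶠ[𝓝 x] fun _ => 0) := by
  by_cases hx : x ∈ interior S
  · left
    refine ⟨hx, ?_⟩
    filter_upwards [isOpen_interior.mem_nhds hx] with y hy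
    exact Set.indicator_of_mem (interior_subset hy) _
  right
  by_cases hxS : x ∈ S
  · have h0 : evalAt P x = 0 := hP x ⟨subset_closure hxS, hx⟩
    have hlt : |((n : ℝ) + 1) * evalAt P x| < 1 := by simp [h0]
    refine ⟨fun _ => hlt, ?_⟩
    have hc : Continuous fun y : Plane => |((n : ℝ) + 1) * evalAt P y| :=
      (continuous_const.mul (continuous_evalAt P)).abs
    filter_upwards [(isOpen_lt hc continuous_const).mem_nhds hlt] with y hy
    by_cases hyS : y ∈ S
    · rw [truncation, Set.indicator_of_mem hyS, cutoff_of_abs_le (le_of_lt hy), zero_div]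
    · rw [truncation, Set.indicator_of_notMem hyS]
  · refine ⟨fun h => absurd h hxS, ?_⟩
    filter_upwards [hS.isOpen_compl.mem_nhds hxS] with y hy
    exact Set.indicator_of_notMem hy _

theorem contDiff_truncation (hS : IsClosed S) (hP : ∀ x ∈ frontier S, evalAt P x = 0) (n : ℕ) :
    ContDiff ℝ ∞ (truncation S P n) := by
  rw [contDiff_iff_contDiffAt]
  intro x
  rcases truncation_eventuallyEq hS hP n x with ⟨_, h⟩ | ⟨_, h⟩
  · exact (contDiff_cutoff_evalAt P n).contDiffAt.congr_of_eventuallyEq h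
  · exact contDiffAt_const.congr_of_eventuallyEq h

theorem partialDeriv_truncation (hS : IsClosed S) (hP : ∀ x ∈ frontier S, evalAt P x = 0)
    (n : ℕ) (i : Fin 2) :
    partialDeriv i (truncation S P n) =
      S.indicator fun x => deriv cutoff ((n + 1) * evalAt P x) * evalAt (pderiv i P) x := by
  ext x
  rw [partialDeriv]
  rcases truncation_eventuallyEq hS hP n x with ⟨hx, h⟩ | ⟨hx, h⟩
  · rw [h.fderiv_eq, Set.indicator_of_mem (interior_subset hx)]
    have hP' := hasFDerivAt_evalAt P x
    have hc : HasDerivAt cutoff (deriv cutoff ((n + 1) * evalAt P x)) ((n + 1) * evalAt P x) :=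
      ((contDiff_cutoff (n := 1)).differentiable (by simp) _).hasDerivAt
    have h1 := (hc.comp_hasFDerivAt x (hP'.const_mul ((n : ℝ) + 1))).mul_const
      ((n + 1 : ℝ)⁻¹)
    simp only [← div_eq_mul_inv] at h1
    have hn : (n + 1 : ℝ) ≠ 0 := by positivity
    have h2 : fderiv ℝ (fun x => cutoff ((n + 1) * evalAt P x) / (n + 1)) x = _ := h1.fderiv
    rw [h2, ← fderiv_evalAt_single P x i, hP'.fderiv]
    simp only [smul_apply, smul_eq_mul]
    field_simp
  · rw [h.fderiv_eq]
    by_cases hxS : x ∈ S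
    · rw [Set.indicator_of_mem hxS, deriv_cutoff_of_abs_lt (hx hxS)]
      simp
    · rw [Set.indicator_of_notMem hxS]
      simp

theorem tsupport_truncation_subset (hS : IsClosed S)
    (hP : ∀ x ∈ frontier S, evalAt P x = 0) (n : ℕ) :
    tsupport (truncation S P n) ⊆ interior S := by
  have hcl : IsClosed {x | x ∈ S ∧ 1 ≤ |(n + 1) * evalAt P x|} :=
    hS.inter (isClosed_le continuous_const
      (continuous_const.mul (continuous_evalAt P)).abs)
  refine (closure_minimal (fun x hx => ?_) hcl).trans fun x hx => ?_
  · by_contra hx'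
    refine hx ?_
    by_cases hxS : x ∈ S
    · have : |((n : ℝ) + 1) * evalAt P x| ≤ 1 := by
        by_contra h
        exact hx' ⟨hxS, le_of_not_ge h⟩
      rw [truncation, Set.indicator_of_mem hxS, cutoff_of_abs_le this, zero_div]
    · rw [truncation, Set.indicator_of_notMem hxS]
  · by_contra hx'
    have := hP x ⟨subset_closure hx.1, hx'⟩
    have h2 := hx.2
    rw [this] at h2
    norm_num at h2

theorem isTest_truncation (hS : IsCompact S) (hP : ∀ x ∈ frontier S, evalAt P x = 0) (n : ℕ)
    {Ω : Set Plane} (hΩ : interior S ⊆ Ω) : IsTest Ω (truncation S P n) :=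
  ⟨contDiff_truncation hS.isClosed hP n,
    hS.of_isClosed_subset (isClosed_tsupport _)
      ((tsupport_truncation_subset hS.isClosed hP n).trans interior_subset),
    (tsupport_truncation_subset hS.isClosed hP n).trans hΩ⟩

theorem abs_truncation_le (n : ℕ) (x : Plane) :
    |truncation S P n x| ≤ S.indicator (fun x => |evalAt P x|) x := by
  by_cases hx : x ∈ S
  · rw [truncation, Set.indicator_of_mem hx, Set.indicator_of_mem hx, abs_div,
      abs_of_pos (by positivity : (0 : ℝ) < n + 1), div_le_iff₀ (by positivity)]
    refine (abs_cutoff_le _).trans ?_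
    rw [abs_mul, abs_of_pos (by positivity : (0 : ℝ) < n + 1), mul_comm]
  · simp [truncation, hx]

/-- Where `P` does not vanish, the arguments of the cutoff are eventually large. -/
theorem eventually_two_lt_mul_evalAt {x : Plane} (hx : evalAt P x ≠ 0) :
    ∀ᶠ n : ℕ in atTop, 2 < |((n : ℝ) + 1) * evalAt P x| := by
  have h : Tendsto (fun n : ℕ => ((n : ℝ) + 1) * |evalAt P x|) atTop atTop :=
    (tendsto_atTop_add_const_right _ _ tendsto_natCast_atTop_atTop).atTop_mul_const
      (abs_pos.mpr hx)
  filter_upwards [h.eventually_gt_atTop 2] with n hn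
  rwa [abs_mul, abs_of_pos (by positivity : (0 : ℝ) < n + 1)]

theorem tendsto_truncation (x : Plane) :
    Tendsto (fun n => truncation S P n x) atTop (𝓝 (S.indicator (evalAt P) x)) := by
  by_cases hx : x ∈ S
  · simp only [truncation, Set.indicator_of_mem hx]
    by_cases h0 : evalAt P x = 0
    · simp [h0, cutoff]
    · refine tendsto_const_nhds.congr' ?_
      filter_upwards [eventually_two_lt_mul_evalAt h0] with n hn
      rw [cutoff_of_two_le hn.le]
      field_simp
  · simp [truncation, hx]

theorem ae_tendsto_partialDeriv_truncation (hS : IsClosed S)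
    (hP : ∀ x ∈ frontier S, evalAt P x = 0) (i : Fin 2) :
    ∀ᵐ x : Plane, Tendsto (fun n => partialDeriv i (truncation S P n) x) atTop
      (𝓝 (S.indicator (evalAt (pderiv i P)) x)) := by
  filter_upwards [ae_pderiv_eq_zero P i] with x hx0
  simp only [partialDeriv_truncation hS hP]
  by_cases hx : x ∈ S
  · simp only [Set.indicator_of_mem hx]
    by_cases h0 : evalAt P x = 0
    · simp [h0, hx0 h0]
    · refine tendsto_const_nhds.congr' ?_
      filter_upwards [eventually_two_lt_mul_evalAt h0] with n hn
      rw [deriv_cutoff_of_two_lt hn, one_mul]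
  · simp [hx]

theorem exists_abs_partialDeriv_truncation_le (hS : IsClosed S)
    (hP : ∀ x ∈ frontier S, evalAt P x = 0) (i : Fin 2) :
    ∃ M : ℝ, 0 ≤ M ∧ ∀ n x, |partialDeriv i (truncation S P n) x| ≤
      S.indicator (fun x => M * |evalAt (pderiv i P) x|) x := by
  obtain ⟨M, hM⟩ := exists_abs_deriv_cutoff_le
  refine ⟨M, (abs_nonneg _).trans (hM 0), fun n x => ?_⟩
  rw [partialDeriv_truncation hS hP]
  by_cases hx : x ∈ S
  · rw [Set.indicator_of_mem hx, Set.indicator_of_mem hx, abs_mul]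
    exact mul_le_mul_of_nonneg_right (hM _) (abs_nonneg _)
  · simp [hx]

end Truncation

/-! ### Weak derivatives of piecewise polynomials -/

theorem tendsto_eLpNorm_sub_of_dominated {μ : Measure Plane} {F : ℕ → Plane → ℝ}
    {f b : Plane → ℝ} (hF : ∀ n, AEStronglyMeasurable (F n) μ) (hf : AEStronglyMeasurable f μ)
    (hb : MemLp b 2 μ) (hFb : ∀ n, ∀ᵐ x ∂μ, |F n x| ≤ b x)
    (hlim : ∀ᵐ x ∂μ, Tendsto (fun n => F n x) atTop (𝓝 (f x))) :
    Tendsto (fun n => eLpNorm (f - F n) 2 μ) atTop (𝓝 0) := by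
  have hfb : ∀ᵐ x ∂μ, |f x| ≤ b x := by
    filter_upwards [hlim, ae_all_iff.mpr hFb] with x hx hxb
    exact le_of_tendsto hx.abs (Eventually.of_forall hxb)
  have h2 : Tendsto (fun n => ∫⁻ x, ‖(f - F n) x‖ₑ ^ (2 : ℝ) ∂μ) atTop (𝓝 0) := by
    have := tendsto_lintegral_of_dominated_convergence'
      (F := fun n x => ‖(f - F n) x‖ₑ ^ (2 : ℝ)) (f := fun _ => 0)
      (bound := fun x => ‖((2 : ℝ) • b) x‖ₑ ^ (2 : ℝ)) (μ := μ)
      (fun n => ((hf.sub (hF n)).enorm.pow_const _)) (fun n => ?_) ?_ ?_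
    · simpa using this
    · filter_upwards [hfb, hFb n] with x h1 h2
      refine ENNReal.rpow_le_rpow ?_ (by norm_num)
      rw [enorm_le_iff_norm_le]
      simp only [Pi.sub_apply, Real.norm_eq_abs, Pi.smul_apply, smul_eq_mul]
      have := abs_sub (f x) (F n x)
      exact (this.trans (by linarith)).trans (le_abs_self (2 * b x))
    · have h := (hb.const_smul (2 : ℝ)).eLpNorm_lt_top
      rw [eLpNorm_lt_top_iff_lintegral_rpow_enorm_lt_top (by norm_num) (by norm_num)] at h
      simpa using h.ne
    · filter_upwards [hlim] with x hx
      have h3 : Tendsto (fun n => f x - F n x) atTop (𝓝 0) := by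
        simpa using (tendsto_const_nhds (x := f x)).sub hx
      have h4 := (h3.enorm).ennrpow_const (2 : ℝ)
      simpa using h4
  simp_rw [eLpNorm_eq_lintegral_rpow_enorm_toReal (p := 2) (by norm_num) (by norm_num)]
  have := h2.ennrpow_const (1 / 2 : ℝ)
  simpa using this

section Domain

variable {Ω : Set Plane}

theorem memL2_weakPartial (Ω : Set Plane) (i : Fin 2) (v : Plane → ℝ) :
    MemL2 Ω (weakPartial Ω i v) := by
  rw [weakPartial]
  split_ifs with h
  · exact h.choose_spec.1
  · exact MemLp.zero'

theorem isWeakPartial_weakPartial {i : Fin 2} {v g : Plane → ℝ} (h : IsWeakPartial Ω i v g) :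
    IsWeakPartial Ω i v (weakPartial Ω i v) := by
  have h' : ∃ g, IsWeakPartial Ω i v g := ⟨g, h⟩
  rw [weakPartial, dif_pos h']
  exact h'.choose_spec

theorem IsTest.memL2 {φ : Plane → ℝ} (hφ : IsTest Ω φ) : MemL2 Ω φ :=
  (hφ.1.continuous.memLp_of_hasCompactSupport hφ.2.1).restrict _

theorem IsTest.continuous_partialDeriv {φ : Plane → ℝ} (hφ : IsTest Ω φ) (i : Fin 2) :
    Continuous (partialDeriv i φ) :=
  (hφ.1.continuous_fderiv (by simp)).clm_apply continuous_const

theorem IsTest.memL2_partialDeriv {φ : Plane → ℝ} (hφ : IsTest Ω φ) (i : Fin 2) :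
    MemL2 Ω (partialDeriv i φ) := by
  have : HasCompactSupport (partialDeriv i φ) := hφ.2.1.fderiv_apply ℝ _
  exact ((hφ.continuous_partialDeriv i).memLp_of_hasCompactSupport this).restrict _

theorem IsWeakPartial.ae_eq (hΩ : IsOpen Ω) {i : Fin 2} {v g g' : Plane → ℝ}
    (h : IsWeakPartial Ω i v g) (h' : IsWeakPartial Ω i v g') :
    g =ᵐ[volume.restrict Ω] g' := by
  have hgg : MemL2 Ω (g - g') := h.1.sub h'.1
  have hloc : LocallyIntegrableOn (g - g') Ω volume := by
    rw [locallyIntegrableOn_iff hΩ.isLocallyClosed]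
    intro k hk hkc
    have : IsFiniteMeasure (volume.restrict k) := ⟨by simpa using hkc.measure_lt_top⟩
    have h1 : MemLp (g - g') 2 (volume.restrict k) :=
      MemLp.mono_measure (Measure.restrict_mono hk le_rfl) hgg
    exact h1.integrable (by norm_num)
  have := hΩ.ae_eq_zero_of_integral_contDiff_smul_eq_zero hloc fun φ h1 h2 h3 => ?_
  · rw [Filter.EventuallyEq, ae_restrict_iff' hΩ.measurableSet]
    filter_upwards [this] with x hx hxΩ
    exact sub_eq_zero.mp (hx hxΩ)
  · have hφ : IsTest Ω φ := ⟨h1, h2, h3⟩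
    have e := (h.2 φ hφ).symm.trans (h'.2 φ hφ)
    have hi : Integrable (fun x => g x * φ x) (volume.restrict Ω) := h.1.integrable_mul hφ.memL2
    have hi' : Integrable (fun x => g' x * φ x) (volume.restrict Ω) :=
      h'.1.integrable_mul hφ.memL2
    have h4 : ∫ x in Ω, φ x • (g - g') x = 0 := by
      have : ∀ x, φ x • (g - g') x = g x * φ x - g' x * φ x := by
        intro x; simp only [Pi.sub_apply, smul_eq_mul]; ring
      simp_rw [this]
      rw [integral_sub hi hi']
      linarith
    rw [← h4]
    refine (setIntegral_eq_integral_of_forall_compl_eq_zero fun x hx => ?_).symm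
    rw [image_eq_zero_of_notMem_tsupport fun h => hx (h3 h), zero_smul]

theorem weakPartial_ae_eq (hΩ : IsOpen Ω) {i : Fin 2} {v g : Plane → ℝ}
    (h : IsWeakPartial Ω i v g) : weakPartial Ω i v =ᵐ[volume.restrict Ω] g :=
  (isWeakPartial_weakPartial h).ae_eq hΩ h

theorem IsWeakPartial.congr_ae {i : Fin 2} {v v' g : Plane → ℝ} (h : IsWeakPartial Ω i v g)
    (hv : v' =ᵐ[volume.restrict Ω] v) : IsWeakPartial Ω i v' g := by
  refine ⟨h.1, fun φ hφ => ?_⟩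
  rw [← h.2 φ hφ]
  refine integral_congr_ae ?_
  filter_upwards [hv] with x hx
  rw [hx]

theorem IsWeakPartial.neg {i : Fin 2} {v g : Plane → ℝ} (h : IsWeakPartial Ω i v g) :
    IsWeakPartial Ω i (-v) (-g) := by
  refine ⟨h.1.neg, fun φ hφ => ?_⟩
  simp only [Pi.neg_apply, neg_mul, integral_neg, h.2 φ hφ]

theorem IsWeakPartial.sub {i : Fin 2} {v v' g g' : Plane → ℝ} (hv : MemL2 Ω v)
    (hv' : MemL2 Ω v') (h : IsWeakPartial Ω i v g) (h' : IsWeakPartial Ω i v' g') :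
    IsWeakPartial Ω i (v - v') (g - g') := by
  refine ⟨h.1.sub h'.1, fun φ hφ => ?_⟩
  have h1 : Integrable (fun x => v x * partialDeriv i φ x) (volume.restrict Ω) :=
    hv.integrable_mul (hφ.memL2_partialDeriv i)
  have h2 : Integrable (fun x => v' x * partialDeriv i φ x) (volume.restrict Ω) :=
    hv'.integrable_mul (hφ.memL2_partialDeriv i)
  have h3 : Integrable (fun x => g x * φ x) (volume.restrict Ω) := h.1.integrable_mul hφ.memL2
  have h4 : Integrable (fun x => g' x * φ x) (volume.restrict Ω) := h'.1.integrable_mul hφ.memL2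
  simp only [Pi.sub_apply, sub_mul]
  rw [integral_sub h1 h2, integral_sub h3 h4, h.2 φ hφ, h'.2 φ hφ]
  ring

theorem weakPartial_sub_ae_eq (hΩ : IsOpen Ω) {v v' : Plane → ℝ} (hv : MemH1 Ω v)
    (hv' : MemH1 Ω v') (i : Fin 2) :
    weakPartial Ω i (v - v') =ᵐ[volume.restrict Ω] weakPartial Ω i v - weakPartial Ω i v' := by
  obtain ⟨g, hg⟩ := hv.2 i
  obtain ⟨g', hg'⟩ := hv'.2 i
  exact weakPartial_ae_eq hΩ
    ((isWeakPartial_weakPartial hg).sub hv.1 hv'.1 (isWeakPartial_weakPartial hg'))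

theorem MemH1.congr_ae {v v' : Plane → ℝ} (h : MemH1 Ω v)
    (hv : v' =ᵐ[volume.restrict Ω] v) : MemH1 Ω v' :=
  ⟨MemLp.ae_eq hv.symm h.1, fun i => (h.2 i).imp fun _ hg => hg.congr_ae hv⟩

theorem MemH1.neg {v : Plane → ℝ} (h : MemH1 Ω v) : MemH1 Ω (-v) :=
  ⟨h.1.neg, fun i => let ⟨g, hg⟩ := h.2 i; ⟨-g, hg.neg⟩⟩

end Domain

section Bubble

variable {S : Set Plane} {P : MvPolynomial (Fin 2) ℝ} {Ω : Set Plane}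

theorem memLp_indicator_of_continuous (hS : IsCompact S) {f : Plane → ℝ} (hf : Continuous f)
    (p : ENNReal) : MemLp (S.indicator f) p volume := by
  rw [memLp_indicator_iff_restrict hS.measurableSet]
  obtain ⟨M, hM⟩ := hS.exists_bound_of_continuousOn hf.continuousOn
  have : IsFiniteMeasure (volume.restrict S) := ⟨by simpa using hS.measure_lt_top⟩
  refine MemLp.of_bound hf.aestronglyMeasurable M ?_
  exact (ae_restrict_iff' hS.measurableSet).mpr (Eventually.of_forall hM)

/-- Integration by parts without boundary terms, for a polynomial that vanishes on the frontier. -/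
theorem setIntegral_evalAt_mul_partialDeriv (hS : IsCompact S)
    (hP : ∀ x ∈ frontier S, evalAt P x = 0) {ψ : Plane → ℝ} (hψ : ContDiff ℝ ∞ ψ) (i : Fin 2) :
    ∫ x in S, evalAt P x * partialDeriv i ψ x = - ∫ x in S, evalAt (pderiv i P) x * ψ x := by
  have hψc : Continuous (partialDeriv i ψ) :=
    (hψ.continuous_fderiv (by simp)).clm_apply continuous_const
  have hT : ∀ n, IsTest Set.univ (truncation S P n) := fun n =>
    isTest_truncation hS hP n (Set.subset_univ _)
  have hn : ∀ n, ∫ x, truncation S P n x * partialDeriv i ψ x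
      = - ∫ x, partialDeriv i (truncation S P n) x * ψ x := by
    intro n
    have hc : HasCompactSupport (truncation S P n) := (hT n).2.1
    have hc' : HasCompactSupport (partialDeriv i (truncation S P n)) := hc.fderiv_apply ℝ _
    have h0 := (hT n).1.continuous
    have h0' := (hT n).continuous_partialDeriv i
    refine integral_mul_fderiv_eq_neg_fderiv_mul_of_integrable ?_ ?_ ?_
      (fun x _ => (hT n).1.differentiable (by simp) x)
      (fun x _ => hψ.differentiable (by simp) x)
    · exact (h0'.mul hψ.continuous).integrable_of_hasCompactSupport hc'.mul_right
    · exact (h0.mul hψc).integrable_of_hasCompactSupport hc.mul_right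
    · exact (h0.mul hψ.continuous).integrable_of_hasCompactSupport hc.mul_right
  have h1 : Tendsto (fun n => ∫ x, truncation S P n x * partialDeriv i ψ x) atTop
      (𝓝 (∫ x, S.indicator (evalAt P) x * partialDeriv i ψ x)) := by
    refine tendsto_integral_of_dominated_convergence
      (S.indicator fun x => |evalAt P x| * |partialDeriv i ψ x|) (fun n => ?_) ?_ (fun n => ?_) ?_
    · exact ((hT n).1.continuous.mul hψc).aestronglyMeasurable
    · exact memLp_one_iff_integrable.mp
        (memLp_indicator_of_continuous hS ((continuous_evalAt P).abs.mul hψc.abs) 1)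
    · refine Eventually.of_forall fun x => ?_
      rw [Real.norm_eq_abs, abs_mul]
      refine (mul_le_mul_of_nonneg_right (abs_truncation_le n x) (abs_nonneg _)).trans ?_
      by_cases hx : x ∈ S <;> simp [hx]
    · exact Eventually.of_forall fun x => (tendsto_truncation x).mul_const _
  have h2 : Tendsto (fun n => ∫ x, partialDeriv i (truncation S P n) x * ψ x) atTop
      (𝓝 (∫ x, S.indicator (evalAt (pderiv i P)) x * ψ x)) := by
    obtain ⟨M, hM, hMle⟩ := exists_abs_partialDeriv_truncation_le hS.isClosed hP i
    refine tendsto_integral_of_dominated_convergence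
      (S.indicator fun x => M * |evalAt (pderiv i P) x| * |ψ x|) (fun n => ?_) ?_ (fun n => ?_) ?_
    · exact (((hT n).continuous_partialDeriv i).mul hψ.continuous).aestronglyMeasurable
    · exact memLp_one_iff_integrable.mp (memLp_indicator_of_continuous hS
        ((continuous_const.mul (continuous_evalAt _).abs).mul hψ.continuous.abs) 1)
    · refine Eventually.of_forall fun x => ?_
      rw [Real.norm_eq_abs, abs_mul]
      refine (mul_le_mul_of_nonneg_right (hMle n x) (abs_nonneg _)).trans ?_
      by_cases hx : x ∈ S <;> simp [hx]
    · filter_upwards [ae_tendsto_partialDeriv_truncation hS.isClosed hP i] with x hx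
      exact hx.mul_const _
  simp_rw [hn] at h1
  have h3 := tendsto_nhds_unique h1 h2.neg
  rw [← integral_indicator hS.measurableSet, ← integral_indicator hS.measurableSet]
  simp only [Set.indicator_mul_left]
  exact h3

theorem setIntegral_pderiv_eq_zero (hS : IsCompact S)
    (hP : ∀ x ∈ frontier S, evalAt P x = 0) (i : Fin 2) :
    ∫ x in S, evalAt (pderiv i P) x = 0 := by
  have := setIntegral_evalAt_mul_partialDeriv hS hP (contDiff_const (c := (1 : ℝ))) i
  simpa [partialDeriv] using this

theorem memL2_indicator (hS : IsCompact S) (P : MvPolynomial (Fin 2) ℝ) (Ω : Set Plane) :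
    MemL2 Ω (S.indicator (evalAt P)) :=
  (memLp_indicator_of_continuous hS (continuous_evalAt P) 2).restrict _

theorem isWeakPartial_indicator (hS : IsCompact S)
    (hP : ∀ x ∈ frontier S, evalAt P x = 0) (Ω : Set Plane) (i : Fin 2) :
    IsWeakPartial Ω i (S.indicator (evalAt P)) (S.indicator (evalAt (pderiv i P))) := by
  refine ⟨memL2_indicator hS _ Ω, fun φ hφ => ?_⟩
  have h := setIntegral_evalAt_mul_partialDeriv hS hP hφ.1 i
  rw [← integral_indicator hS.measurableSet, ← integral_indicator hS.measurableSet] at h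
  simp only [Set.indicator_mul_left] at h
  rw [setIntegral_eq_integral_of_forall_compl_eq_zero,
    setIntegral_eq_integral_of_forall_compl_eq_zero, h]
  · intro x hx
    rw [image_eq_zero_of_notMem_tsupport fun h => hx (hφ.2.2 h), mul_zero]
  · intro x hx
    have : x ∉ tsupport (fderiv ℝ φ) := fun h => hx (hφ.2.2 (tsupport_fderiv_subset ℝ h))
    rw [partialDeriv, image_eq_zero_of_notMem_tsupport this]
    simp

theorem weakPartial_indicator_ae_eq (hΩ : IsOpen Ω) (hS : IsCompact S)
    (hP : ∀ x ∈ frontier S, evalAt P x = 0) (i : Fin 2) :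
    weakPartial Ω i (S.indicator (evalAt P)) =ᵐ[volume.restrict Ω]
      S.indicator (evalAt (pderiv i P)) :=
  weakPartial_ae_eq hΩ (isWeakPartial_indicator hS hP Ω i)

/-- The extension by zero of a polynomial that vanishes on the frontier of `S ⊆ Ω` is in
`H¹₀(Ω)`, since its truncations are test functions that converge to it. -/
theorem memH10_indicator (hΩ : IsOpen Ω) (hS : IsCompact S) (hSΩ : interior S ⊆ Ω)
    (hP : ∀ x ∈ frontier S, evalAt P x = 0) : MemH10 Ω (S.indicator (evalAt P)) := by
  refine ⟨⟨memL2_indicator hS P Ω, fun i => ⟨_, isWeakPartial_indicator hS hP Ω i⟩⟩,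
    truncation S P, fun n => isTest_truncation hS hP n hSΩ, ?_, fun i => ?_⟩
  · refine tendsto_eLpNorm_sub_of_dominated (b := S.indicator fun x => |evalAt P x|)
      (fun n => (contDiff_truncation hS.isClosed hP n).continuous.aestronglyMeasurable)
      (memL2_indicator hS P Ω).1
      ((memLp_indicator_of_continuous hS (continuous_evalAt P).abs 2).restrict _)
      (fun n => Eventually.of_forall (abs_truncation_le n))
      (Eventually.of_forall tendsto_truncation)
  · obtain ⟨M, hM, hMle⟩ := exists_abs_partialDeriv_truncation_le hS.isClosed hP i
    refine tendsto_eLpNorm_sub_of_dominated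
      (b := S.indicator fun x => M * |evalAt (pderiv i P) x|)
      (fun n => ((isTest_truncation hS hP n hSΩ).continuous_partialDeriv i).aestronglyMeasurable)
      (memL2_weakPartial _ _ _).1
      ((memLp_indicator_of_continuous hS
        (continuous_const.mul (continuous_evalAt _).abs) 2).restrict _)
      (fun n => Eventually.of_forall (hMle n)) ?_
    filter_upwards [weakPartial_indicator_ae_eq hΩ hS hP i,
      ae_restrict_of_ae (ae_tendsto_partialDeriv_truncation hS.isClosed hP i)] with x hx hx'
    rwa [hx]

end Bubble

/-! ### Definite forms on finite-dimensional spaces -/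

section LinearAlgebra

variable {U : Type*} [AddCommGroup U] [Module ℝ U] [FiniteDimensional ℝ U]

/-- A definite form on a finite-dimensional space represents every linear functional. -/
theorem exists_forall_apply_eq (a : LinearMap.BilinForm ℝ U) (ha : ∀ u, a u u = 0 → u = 0)
    (l : Module.Dual ℝ U) : ∃ u, ∀ w, a u w = l w := by
  have hinj : Function.Injective a := by
    rw [injective_iff_map_eq_zero]
    intro u hu
    exact ha u (by rw [hu, LinearMap.zero_apply])
  have hsurj : Function.Surjective a :=
    (LinearMap.injective_iff_surjective_of_finrank_eq_finrank
      (Subspace.dual_finrank_eq (K := ℝ) (V := U)).symm).mp hinj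
  obtain ⟨u, hu⟩ := hsurj l
  exact ⟨u, fun w => by rw [hu]⟩

/-- A quadratic form on a finite-dimensional space is dominated by every positive definite one. -/
theorem exists_forall_apply_self_le (a g : LinearMap.BilinForm ℝ U) (hsymm : ∀ u v, a u v = a v u)
    (hnonneg : ∀ u, 0 ≤ a u u) (ha : ∀ u, a u u = 0 → u = 0) :
    ∃ C : ℝ, 0 ≤ C ∧ ∀ u, g u u ≤ C * a u u := by
  let b := Module.finBasis ℝ U
  -- the coordinates are represented by vectors, hence bounded by Cauchy-Schwarz
  choose s hs using fun k => exists_forall_apply_eq a ha (b.coord k)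
  have hcoord : ∀ k w, b.coord k w ^ 2 ≤ a (s k) (s k) * a w w := by
    intro k w
    rw [← hs k w]
    exact LinearMap.BilinForm.apply_sq_le_of_symm a hnonneg ⟨hsymm⟩ _ _
  refine ⟨∑ k, ∑ l, |g (b k) (b l)| * (a (s k) (s k) + a (s l) (s l)), ?_, fun w => ?_⟩
  · exact Finset.sum_nonneg fun k _ => Finset.sum_nonneg fun l _ =>
      mul_nonneg (abs_nonneg _) (add_nonneg (hnonneg _) (hnonneg _))
  have hg : g w w = ∑ k, ∑ l, b.coord k w * (b.coord l w * g (b k) (b l)) := by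
    conv_lhs => rw [← b.sum_repr w]
    simp only [map_sum, LinearMap.sum_apply, map_smul, LinearMap.smul_apply, smul_eq_mul,
      Module.Basis.coord_apply, Finset.mul_sum]
    rw [Finset.sum_comm]
    refine Finset.sum_congr rfl fun k _ => Finset.sum_congr rfl fun l _ => ?_
    ring
  rw [hg, Finset.sum_mul]
  refine Finset.sum_le_sum fun k _ => ?_
  rw [Finset.sum_mul]
  refine Finset.sum_le_sum fun l _ => ?_
  have h1 := hcoord k w
  have h2 := hcoord l w
  have h3 : |b.coord k w * b.coord l w| ≤ (a (s k) (s k) + a (s l) (s l)) * a w w := by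
    rw [abs_le]
    constructor <;> nlinarith [sq_nonneg (b.coord k w + b.coord l w),
      sq_nonneg (b.coord k w - b.coord l w), sq_nonneg (b.coord k w), sq_nonneg (b.coord l w)]
  calc b.coord k w * (b.coord l w * g (b k) (b l))
      = g (b k) (b l) * (b.coord k w * b.coord l w) := by ring
    _ ≤ |g (b k) (b l)| * |b.coord k w * b.coord l w| := by
      rw [← abs_mul]; exact le_abs_self _
    _ ≤ |g (b k) (b l)| * ((a (s k) (s k) + a (s l) (s l)) * a w w) :=
      mul_le_mul_of_nonneg_left h3 (abs_nonneg _)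
    _ = _ := by ring

end LinearAlgebra

/-! ### The `L²` inner product of polynomials -/

section Form

variable {S : Set Plane}

theorem memLp_evalAt (hS : IsCompact S) (P : MvPolynomial (Fin 2) ℝ) :
    MemLp (evalAt P) 2 (volume.restrict S) :=
  (memLp_indicator_iff_restrict hS.measurableSet).mp
    (memLp_indicator_of_continuous hS (continuous_evalAt P) 2)

theorem integrable_mul_evalAt (hS : IsCompact S) {g : Plane → ℝ}
    (hg : MemLp g 2 (volume.restrict S)) (P : MvPolynomial (Fin 2) ℝ) :
    Integrable (fun x => g x * evalAt P x) (volume.restrict S) :=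
  hg.integrable_mul (memLp_evalAt hS P)

theorem integrable_evalAt (hS : IsCompact S) (P : MvPolynomial (Fin 2) ℝ) :
    Integrable (evalAt P) (volume.restrict S) := by
  simpa using integrable_mul_evalAt hS (memLp_evalAt hS 1) P

theorem integrable_evalAt_sq (hS : IsCompact S) (P : MvPolynomial (Fin 2) ℝ) :
    Integrable (fun x => evalAt P x ^ 2) (volume.restrict S) := by
  simpa only [sq] using integrable_mul_evalAt hS (memLp_evalAt hS P) P

/-- The functional `P ↦ ∫_S g P` on polynomials. -/
def moment (hS : IsCompact S) {g : Plane → ℝ} (hg : MemLp g 2 (volume.restrict S)) :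
    MvPolynomial (Fin 2) ℝ →ₗ[ℝ] ℝ where
  toFun P := ∫ x in S, g x * evalAt P x
  map_add' P Q := by
    simp only [evalAt_add, mul_add]
    exact integral_add (integrable_mul_evalAt hS hg P) (integrable_mul_evalAt hS hg Q)
  map_smul' c P := by
    simp only [evalAt_smul, RingHom.id_apply, smul_eq_mul, ← integral_const_mul]
    congr 1 with x
    ring

@[simp] theorem moment_apply (hS : IsCompact S) {g : Plane → ℝ}
    (hg : MemLp g 2 (volume.restrict S)) (P : MvPolynomial (Fin 2) ℝ) :
    moment hS hg P = ∫ x in S, g x * evalAt P x := rfl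

/-- The `L²(S)` inner product of two polynomials. -/
def l2Form (hS : IsCompact S) : LinearMap.BilinForm ℝ (MvPolynomial (Fin 2) ℝ) :=
  LinearMap.mk₂ ℝ (fun P Q => moment hS (memLp_evalAt hS P) Q)
    (fun P P' Q => by
      simp only [moment_apply, evalAt_add, add_mul]
      exact integral_add (integrable_mul_evalAt hS (memLp_evalAt hS P) Q)
        (integrable_mul_evalAt hS (memLp_evalAt hS P') Q))
    (fun c P Q => by
      simp only [moment_apply, evalAt_smul, smul_eq_mul, ← integral_const_mul, mul_assoc])
    (fun _ _ _ => map_add _ _ _) (fun _ _ _ => map_smul _ _ _)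

@[simp] theorem l2Form_apply (hS : IsCompact S) (P Q : MvPolynomial (Fin 2) ℝ) :
    l2Form hS P Q = ∫ x in S, evalAt P x * evalAt Q x := rfl

theorem l2Form_comm (hS : IsCompact S) (P Q : MvPolynomial (Fin 2) ℝ) :
    l2Form hS P Q = l2Form hS Q P := by
  simp only [l2Form_apply, mul_comm]

theorem l2Form_self_nonneg (hS : IsCompact S) (P : MvPolynomial (Fin 2) ℝ) :
    0 ≤ l2Form hS P P :=
  integral_nonneg fun _ => mul_self_nonneg _

theorem eq_of_evalAt_eq {P Q : MvPolynomial (Fin 2) ℝ} (h : ∀ x, evalAt P x = evalAt Q x) :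
    P = Q :=
  MvPolynomial.funext fun x => h (WithLp.toLp 2 x)

/-- Polynomials that agree almost everywhere on a set with interior points are equal. -/
theorem eq_of_evalAt_ae_eq (hS : (interior S).Nonempty) {P Q : MvPolynomial (Fin 2) ℝ}
    (h : evalAt P =ᵐ[volume.restrict S] evalAt Q) : P = Q := by
  have h1 : Set.EqOn (evalAt P) (evalAt Q) (interior S) :=
    Measure.eqOn_open_of_ae_eq (ae_restrict_of_ae_restrict_of_subset interior_subset h)
      isOpen_interior (continuous_evalAt P).continuousOn (continuous_evalAt Q).continuousOn
  obtain ⟨x, hx⟩ := hS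
  have hA : ∀ R : MvPolynomial (Fin 2) ℝ, AnalyticOnNhd ℝ (evalAt R) Set.univ := fun R =>
    contDiff_omega_iff_analyticOnNhd.mp (contDiff_evalAt R)
  have h2 := (hA P).eq_of_eventuallyEq (hA Q)
    (h1.eventuallyEq_of_mem (isOpen_interior.mem_nhds hx))
  exact eq_of_evalAt_eq (congrFun h2)

theorem eq_zero_of_l2Form_self (hS : IsCompact S) (hS' : (interior S).Nonempty)
    {P : MvPolynomial (Fin 2) ℝ} (h : l2Form hS P P = 0) : P = 0 := by
  refine eq_of_evalAt_ae_eq hS' ?_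
  rw [l2Form_apply, integral_eq_zero_iff_of_nonneg (fun _ => mul_self_nonneg _)
    (integrable_mul_evalAt hS (memLp_evalAt hS P) P)] at h
  filter_upwards [h] with x hx
  simpa using hx

end Form

/-! ### Bubble fields as polynomials -/

theorem totalDegree_pderiv_le (i : Fin 2) {k : ℕ} {P : MvPolynomial (Fin 2) ℝ}
    (hP : P.totalDegree ≤ k + 1) : (pderiv i P).totalDegree ≤ k := by
  rw [P.as_sum, map_sum]
  refine totalDegree_finsetSum_le fun d hd => ?_
  rw [pderiv_monomial]
  by_cases h0 : d i = 0
  · simp [h0]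
  refine (totalDegree_monomial_le _ _).trans ?_
  have h1 := (le_totalDegree hd).trans hP
  rw [Finsupp.sum_fintype _ _ (by simp), Fin.sum_univ_two] at h1 ⊢
  fin_cases i <;> simp_all <;> omega

/-- The divergence of a field of polynomials. -/
def divPoly : (Fin 2 → MvPolynomial (Fin 2) ℝ) →ₗ[ℝ] MvPolynomial (Fin 2) ℝ :=
  ∑ i, (pderiv i).toLinearMap ∘ₗ LinearMap.proj i

theorem divPoly_apply (P : Fin 2 → MvPolynomial (Fin 2) ℝ) :
    divPoly P = ∑ i, pderiv i (P i) := by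
  simp [divPoly]

/-- The fields of polynomials of degree at most four that vanish on the frontier of `S`. -/
def bubblePoly (S : Set Plane) : Submodule ℝ (Fin 2 → MvPolynomial (Fin 2) ℝ) where
  carrier := {P | ∀ i, (P i).totalDegree ≤ 4 ∧ ∀ x ∈ frontier S, evalAt (P i) x = 0}
  add_mem' {P Q} hP hQ i := ⟨(totalDegree_add _ _).trans (max_le (hP i).1 (hQ i).1),
    fun x hx => by simp [(hP i).2 x hx, (hQ i).2 x hx]⟩
  zero_mem' i := by simp
  smul_mem' c P hP i := ⟨(totalDegree_smul_le _ _).trans (hP i).1,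
    fun x hx => by simp [(hP i).2 x hx]⟩

instance (S : Set Plane) : FiniteDimensional ℝ (bubblePoly S) := by
  let f : bubblePoly S →ₗ[ℝ] (Fin 2 → restrictTotalDegree (Fin 2) ℝ 4) :=
    LinearMap.pi fun i => LinearMap.codRestrict _
      (LinearMap.proj i ∘ₗ (bubblePoly S).subtype)
      fun P => (mem_restrictTotalDegree _ _ _).mpr (P.2 i).1
  refine Module.Finite.of_injective f fun P Q h => ?_
  ext1
  funext i
  exact congrArg Subtype.val (congrFun h i)

theorem totalDegree_divPoly_le {S : Set Plane} {P : Fin 2 → MvPolynomial (Fin 2) ℝ}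
    (hP : P ∈ bubblePoly S) : (divPoly P).totalDegree ≤ 3 := by
  rw [divPoly_apply]
  exact totalDegree_finsetSum_le fun i _ => totalDegree_pderiv_le i (hP i).1

theorem setIntegral_divPoly {S : Set Plane} (hS : IsCompact S)
    {P : Fin 2 → MvPolynomial (Fin 2) ℝ} (hP : P ∈ bubblePoly S) :
    ∫ x in S, evalAt (divPoly P) x = 0 := by
  simp only [divPoly_apply, Fin.sum_univ_two, evalAt_add]
  rw [integral_add (integrable_evalAt hS _) (integrable_evalAt hS _),
    setIntegral_pderiv_eq_zero hS (hP 0).2, setIntegral_pderiv_eq_zero hS (hP 1).2, add_zero]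

/-- The expansion of a polynomial of degree at most `k` in monomials. -/
theorem exists_evalAt_eq_sum {k : ℕ} {P : MvPolynomial (Fin 2) ℝ} (hP : P.totalDegree ≤ k) :
    ∃ c : ℕ → ℕ → ℝ, ∀ x : Plane, evalAt P x =
      ∑ i ∈ Finset.range (k + 1), ∑ j ∈ Finset.range (k + 1 - i), c i j * x 0 ^ i * x 1 ^ j := by
  refine ⟨fun i j => coeff (Finsupp.single 0 i + Finsupp.single 1 j) P, fun x => ?_⟩
  have hd : ∀ d : Fin 2 →₀ ℕ, Finsupp.single 0 (d 0) + Finsupp.single 1 (d 1) = d := by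
    intro d
    ext j
    fin_cases j <;> simp
  rw [evalAt, eval_eq', Finset.sum_sigma']
  refine Finset.sum_of_injOn (fun d => ⟨d 0, d 1⟩) ?_ ?_ ?_ ?_
  · intro d _ d' _ h
    simp only [Sigma.mk.injEq, heq_eq_eq] at h
    rw [← hd d, ← hd d', h.1, h.2]
  · intro d hdP
    have h1 := (le_totalDegree hdP).trans hP
    rw [Finsupp.sum_fintype _ _ (by simp), Fin.sum_univ_two] at h1
    simp
    omega
  · rintro ⟨i, j⟩ _ hij
    have : coeff (Finsupp.single 0 i + Finsupp.single 1 j) P = 0 := by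
      by_contra hne
      refine hij ⟨Finsupp.single 0 i + Finsupp.single 1 j, mem_support_iff.mpr hne, ?_⟩
      simp
    simp [this]
  · intro d _
    simp only [hd, Fin.prod_univ_two, mul_assoc]

/-! ### Affine changes of coordinates -/

/-- The affine map `x ↦ M x + t` of the plane. -/
def affMap (M : Matrix (Fin 2) (Fin 2) ℝ) (t : Plane) (x : Plane) : Plane :=
  Matrix.toEuclideanLin M x + t

/-- The substitution of the affine map `x ↦ M x + t` into polynomials. -/
def affSubst (M : Matrix (Fin 2) (Fin 2) ℝ) (t : Plane) :
    MvPolynomial (Fin 2) ℝ →ₐ[ℝ] MvPolynomial (Fin 2) ℝ :=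
  aeval fun i => ∑ j, C (M i j) * X j + C (t i)

section Affine

variable {M : Matrix (Fin 2) (Fin 2) ℝ} {t : Plane}

theorem affMap_apply (M : Matrix (Fin 2) (Fin 2) ℝ) (t x : Plane) (i : Fin 2) :
    affMap M t x i = ∑ j, M i j * x j + t i := by
  fin_cases i <;> simp [affMap, Matrix.toEuclideanLin, Matrix.toLpLin_apply]

theorem toEuclideanLin_toEuclideanLin (M N : Matrix (Fin 2) (Fin 2) ℝ) (x : Plane) :
    Matrix.toEuclideanLin M (Matrix.toEuclideanLin N x) = Matrix.toEuclideanLin (M * N) x := by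
  rw [Matrix.toEuclideanLin, Matrix.toLpLin_mul_same, LinearMap.comp_apply]

theorem evalAt_affSubst (M : Matrix (Fin 2) (Fin 2) ℝ) (t : Plane)
    (P : MvPolynomial (Fin 2) ℝ) (x : Plane) :
    evalAt (affSubst M t P) x = evalAt P (affMap M t x) := by
  induction P using MvPolynomial.induction_on with
  | C a => rw [← algebraMap_eq, AlgHom.commutes]; simp [algebraMap_eq]
  | add p q hp hq => simp [hp, hq]
  | mul_X p j hp =>
    rw [map_mul, evalAt_mul, hp, evalAt_mul]
    congr 1
    simp [affSubst, affMap_apply]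

theorem totalDegree_affSubst_le (M : Matrix (Fin 2) (Fin 2) ℝ) (t : Plane)
    (P : MvPolynomial (Fin 2) ℝ) : (affSubst M t P).totalDegree ≤ P.totalDegree := by
  rw [affSubst, aeval_def, eval₂_eq']
  refine totalDegree_finsetSum_le fun d hd => ?_
  refine le_trans ?_ (le_totalDegree hd)
  rw [algebraMap_eq, Finsupp.sum_fintype _ _ (by simp)]
  refine (totalDegree_mul _ _).trans ?_
  rw [totalDegree_C, zero_add]
  refine (totalDegree_finsetProd _ _).trans (Finset.sum_le_sum fun i _ => ?_)
  refine (totalDegree_pow _ _).trans (mul_le_of_le_one_right (Nat.zero_le _) ?_)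
  refine (totalDegree_add _ _).trans (max_le ?_ (by simp))
  refine totalDegree_finsetSum_le fun j _ => (totalDegree_mul _ _).trans ?_
  simp

theorem pderiv_affSubst (M : Matrix (Fin 2) (Fin 2) ℝ) (t : Plane)
    (P : MvPolynomial (Fin 2) ℝ) (l : Fin 2) :
    pderiv l (affSubst M t P) = ∑ k, C (M k l) * affSubst M t (pderiv k P) := by
  induction P using MvPolynomial.induction_on with
  | C a => rw [← algebraMap_eq, AlgHom.commutes]; simp [algebraMap_eq]
  | add p q hp hq => simp [hp, hq, mul_add, Finset.sum_add_distrib]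
  | mul_X p j hp =>
    have hX : pderiv l (affSubst M t (X j)) = C (M j l) := by
      fin_cases l <;> simp [affSubst, pderiv_X]
    rw [map_mul, Derivation.leibniz, hp, hX]
    simp only [smul_eq_mul, Derivation.leibniz, map_add, map_mul, pderiv_X, Fin.sum_univ_two]
    fin_cases j <;> simp <;> ring

variable (M t) in
/-- The translation part of the inverse of `x ↦ M x + t`. -/
def invShift : Plane := -Matrix.toEuclideanLin M⁻¹ t

theorem affMap_inv_affMap (hM : M.det ≠ 0) (x : Plane) :
    affMap M⁻¹ (invShift M t) (affMap M t x) = x := by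
  have h : M⁻¹ * M = 1 := Matrix.nonsing_inv_mul _ (isUnit_iff_ne_zero.mpr hM)
  simp only [affMap, invShift, map_add, add_neg_cancel_right, toEuclideanLin_toEuclideanLin, h]
  simp [Matrix.toEuclideanLin]

theorem affMap_affMap_inv (hM : M.det ≠ 0) (x : Plane) :
    affMap M t (affMap M⁻¹ (invShift M t) x) = x := by
  have h : M * M⁻¹ = 1 := Matrix.mul_nonsing_inv _ (isUnit_iff_ne_zero.mpr hM)
  simp only [affMap, invShift, map_add, map_neg, toEuclideanLin_toEuclideanLin, h]
  simp [Matrix.toEuclideanLin]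

theorem affSubst_inv_affSubst (hM : M.det ≠ 0) (P : MvPolynomial (Fin 2) ℝ) :
    affSubst M⁻¹ (invShift M t) (affSubst M t P) = P :=
  eq_of_evalAt_eq fun x => by simp only [evalAt_affSubst, affMap_affMap_inv hM]

theorem affSubst_injective (hM : M.det ≠ 0) : Function.Injective (affSubst M t) :=
  Function.LeftInverse.injective (affSubst_inv_affSubst hM)

theorem affSubst_affSubst_inv (hM : M.det ≠ 0) (P : MvPolynomial (Fin 2) ℝ) :
    affSubst M t (affSubst M⁻¹ (invShift M t) P) = P :=
  eq_of_evalAt_eq fun x => by simp only [evalAt_affSubst, affMap_inv_affMap hM]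

theorem hasFDerivAt_affMap (M : Matrix (Fin 2) (Fin 2) ℝ) (t x : Plane) :
    HasFDerivAt (affMap M t) (Matrix.toEuclideanLin M).toContinuousLinearMap x :=
  (Matrix.toEuclideanLin M).toContinuousLinearMap.hasFDerivAt.add_const t

theorem continuous_affMap (M : Matrix (Fin 2) (Fin 2) ℝ) (t : Plane) : Continuous (affMap M t) :=
  (Matrix.toEuclideanLin M).continuous_of_finiteDimensional.add continuous_const

/-- An invertible affine map as a homeomorphism. -/
def affHomeomorph (hM : M.det ≠ 0) (t : Plane) : Plane ≃ₜ Plane where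
  toFun := affMap M t
  invFun := affMap M⁻¹ (invShift M t)
  left_inv := affMap_inv_affMap hM
  right_inv := affMap_affMap_inv hM
  continuous_toFun := continuous_affMap _ _
  continuous_invFun := continuous_affMap _ _

theorem frontier_image_affMap (hM : M.det ≠ 0) (S : Set Plane) :
    frontier (affMap M t '' S) = affMap M t '' frontier S :=
  ((affHomeomorph hM t).image_frontier S).symm

theorem interior_image_affMap (hM : M.det ≠ 0) (S : Set Plane) :
    interior (affMap M t '' S) = affMap M t '' interior S :=
  ((affHomeomorph hM t).image_interior S).symm

/-- The factor by which an affine map changes areas. -/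
theorem exists_setIntegral_image_affMap (hM : M.det ≠ 0) (t : Plane) :
    ∃ δ : ℝ, 0 ≤ δ ∧ ∀ {S : Set Plane}, MeasurableSet S → ∀ g : Plane → ℝ,
      ∫ x in affMap M t '' S, g x = δ * ∫ x in S, g (affMap M t x) := by
  refine ⟨|(Matrix.toEuclideanLin M).toContinuousLinearMap.det|, abs_nonneg _,
    fun hS g => ?_⟩
  rw [integral_image_eq_integral_abs_det_fderiv_smul volume hS
    (fun x _ => (hasFDerivAt_affMap M t x).hasFDerivWithinAt)
    ((affHomeomorph hM t).injective.injOn) g, ← integral_const_mul]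
  simp only [smul_eq_mul]

/-- The Piola transform, up to the factor `det M`: it turns fields on the image of `S` under
`x ↦ M x + t` into fields on `S` and is compatible with the divergence. -/
def piola (M : Matrix (Fin 2) (Fin 2) ℝ) (t : Plane) (P : Fin 2 → MvPolynomial (Fin 2) ℝ) :
    Fin 2 → MvPolynomial (Fin 2) ℝ :=
  fun k => ∑ i, M.adjugate k i • affSubst M t (P i)

theorem evalAt_pderiv_piola (P : Fin 2 → MvPolynomial (Fin 2) ℝ) (k l : Fin 2) (x : Plane) :
    evalAt (pderiv l (piola M t P k)) x =
      ∑ i, ∑ j, M.adjugate k i * M j l * evalAt (pderiv j (P i)) (affMap M t x) := by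
  simp only [piola, Fin.sum_univ_two, map_add, Derivation.map_smul, pderiv_affSubst, evalAt_add,
    evalAt_smul, evalAt_mul, evalAt_C, evalAt_affSubst]
  ring

theorem divPoly_piola (P : Fin 2 → MvPolynomial (Fin 2) ℝ) :
    divPoly (piola M t P) = M.det • affSubst M t (divPoly P) := by
  refine eq_of_evalAt_eq fun x => ?_
  simp only [divPoly_apply, evalAt_smul, evalAt_affSubst, Fin.sum_univ_two, evalAt_add,
    evalAt_pderiv_piola, Matrix.adjugate_fin_two, Matrix.det_fin_two]
  simp
  ring

theorem piola_mem_bubblePoly {S S' : Set Plane} (hS : ∀ x ∈ frontier S, affMap M t x ∈ frontier S')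
    {P : Fin 2 → MvPolynomial (Fin 2) ℝ} (hP : P ∈ bubblePoly S') :
    piola M t P ∈ bubblePoly S := by
  refine fun k => ⟨totalDegree_finsetSum_le fun i _ => (totalDegree_smul_le _ _).trans
    ((totalDegree_affSubst_le _ _ _).trans (hP i).1), fun x hx => ?_⟩
  simp only [piola, Fin.sum_univ_two, evalAt_add, evalAt_smul, evalAt_affSubst,
    (hP _).2 _ (hS x hx), mul_zero, add_zero]

/-- The matrix `∇P` is recovered from the gradient of the Piola transform. -/
theorem sum_sq_pderiv_le (P : Fin 2 → MvPolynomial (Fin 2) ℝ) (x : Plane) :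
    M.det ^ 4 * ∑ i, ∑ j, evalAt (pderiv j (P i)) (affMap M t x) ^ 2 ≤
      (∑ i, ∑ j, M i j ^ 2) ^ 2 *
        ∑ k, ∑ l, evalAt (pderiv l (piola M t P k)) x ^ 2 := by
  have key : ∀ i j, M.det ^ 2 * evalAt (pderiv j (P i)) (affMap M t x) =
      ∑ k, ∑ l, M i k * M.adjugate l j * evalAt (pderiv l (piola M t P k)) x := by
    intro i j
    simp only [evalAt_pderiv_piola, Fin.sum_univ_two, Matrix.adjugate_fin_two,
      Matrix.det_fin_two]
    fin_cases i <;> fin_cases j <;> simp <;> ring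
  have hCS : ∀ i j, (M.det ^ 2 * evalAt (pderiv j (P i)) (affMap M t x)) ^ 2 ≤
      (∑ k, M i k ^ 2) * (∑ l, M.adjugate l j ^ 2) *
        ∑ k, ∑ l, evalAt (pderiv l (piola M t P k)) x ^ 2 := by
    intro i j
    rw [key]
    have h := Finset.sum_mul_sq_le_sq_mul_sq (Finset.univ : Finset (Fin 2 × Fin 2))
      (fun kl => M i kl.1 * M.adjugate kl.2 j)
      (fun kl => evalAt (pderiv kl.2 (piola M t P kl.1)) x)
    simp only [Fintype.sum_prod_type, mul_pow] at h
    rwa [Finset.sum_mul_sum]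
  calc M.det ^ 4 * ∑ i, ∑ j, evalAt (pderiv j (P i)) (affMap M t x) ^ 2
      = ∑ i, ∑ j, (M.det ^ 2 * evalAt (pderiv j (P i)) (affMap M t x)) ^ 2 := by
        simp only [Finset.mul_sum]
        refine Finset.sum_congr rfl fun i _ => Finset.sum_congr rfl fun j _ => ?_
        ring
    _ ≤ ∑ i, ∑ j, (∑ k, M i k ^ 2) * (∑ l, M.adjugate l j ^ 2) *
        ∑ k, ∑ l, evalAt (pderiv l (piola M t P k)) x ^ 2 :=
        Finset.sum_le_sum fun i _ => Finset.sum_le_sum fun j _ => hCS i j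
    _ = _ := by
        simp only [Fin.sum_univ_two, Matrix.adjugate_fin_two]
        simp
        ring

end Affine

/-! ### The reference triangle -/

/-- The reference triangle with the vertices `(0, 0)`, `(1, 0)` and `(0, 1)`. -/
def refTri : Set Plane := {x | 0 ≤ x 0 ∧ 0 ≤ x 1 ∧ x 0 + x 1 ≤ 1}

theorem mem_refTri {x : Plane} : x ∈ refTri ↔ 0 ≤ x 0 ∧ 0 ≤ x 1 ∧ x 0 + x 1 ≤ 1 := Iff.rfl

theorem continuous_coord (i : Fin 2) : Continuous fun x : Plane => x i :=
  (EuclideanSpace.proj i : Plane →L[ℝ] ℝ).continuous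

theorem isCompact_refTri : IsCompact refTri := by
  refine Metric.isCompact_of_isClosed_isBounded ?_ ?_
  · exact (isClosed_le continuous_const (continuous_coord 0)).inter
      ((isClosed_le continuous_const (continuous_coord 1)).inter
        (isClosed_le ((continuous_coord 0).add (continuous_coord 1)) continuous_const))
  · refine (Metric.isBounded_closedBall (x := (0 : Plane)) (r := 1)).subset fun x hx => ?_
    obtain ⟨h0, h1, h2⟩ := hx
    rw [mem_closedBall_zero_iff, EuclideanSpace.norm_eq, Real.sqrt_le_left (by norm_num),
      Fin.sum_univ_two]
    simp only [Real.norm_eq_abs, sq_abs]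
    nlinarith

theorem convex_refTri : Convex ℝ refTri := by
  intro x hx y hy a b ha hb hab
  obtain ⟨hx0, hx1, hx2⟩ := hx
  obtain ⟨hy0, hy1, hy2⟩ := hy
  simp only [mem_refTri, PiLp.add_apply, PiLp.smul_apply, smul_eq_mul]
  refine ⟨by positivity, by positivity, ?_⟩
  nlinarith [mul_le_mul_of_nonneg_left hx2 ha, mul_le_mul_of_nonneg_left hy2 hb]

theorem pos_of_mem_interior_refTri {x : Plane} (hx : x ∈ interior refTri) :
    0 < x 0 ∧ 0 < x 1 ∧ x 0 + x 1 < 1 := by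
  have key : ∀ v : Plane, ∃ s : ℝ, 0 < s ∧ x + s • v ∈ refTri := by
    intro v
    have hc : Tendsto (fun s : ℝ => x + s • v) (𝓝 0) (𝓝 x) := by
      have : Continuous fun s : ℝ => x + s • v := by fun_prop
      simpa using this.tendsto 0
    have h := (hc.eventually (mem_interior_iff_mem_nhds.mp hx)).filter_mono
      (nhdsWithin_le_nhds (s := Set.Ioi 0))
    obtain ⟨s, hs, hs'⟩ := (h.and self_mem_nhdsWithin).exists
    exact ⟨s, hs', hs⟩
  obtain ⟨s, hs, h0, h1, -⟩ := key !₂[-1, -1]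
  obtain ⟨r, hr, -, -, h2⟩ := key !₂[1, 1]
  simp at h0 h1 h2
  exact ⟨by linarith, by linarith, by linarith⟩

theorem mem_frontier_refTri {x : Plane} (hx : x ∈ refTri)
    (h : x 0 = 0 ∨ x 1 = 0 ∨ x 0 + x 1 = 1) : x ∈ frontier refTri := by
  refine ⟨subset_closure hx, fun hi => ?_⟩
  obtain ⟨h0, h1, h2⟩ := pos_of_mem_interior_refTri hi
  rcases h with h | h | h <;> linarith

theorem mem_interior_refTri {x : Plane} (h0 : 0 < x 0) (h1 : 0 < x 1) (h2 : x 0 + x 1 < 1) :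
    x ∈ interior refTri := by
  have ho : IsOpen {x : Plane | 0 < x 0 ∧ 0 < x 1 ∧ x 0 + x 1 < 1} :=
    (isOpen_lt continuous_const (continuous_coord 0)).inter
      ((isOpen_lt continuous_const (continuous_coord 1)).inter
        (isOpen_lt ((continuous_coord 0).add (continuous_coord 1)) continuous_const))
  have hsub : {x : Plane | 0 < x 0 ∧ 0 < x 1 ∧ x 0 + x 1 < 1} ⊆ refTri :=
    fun y hy => mem_refTri.mpr ⟨hy.1.le, hy.2.1.le, hy.2.2.le⟩
  exact interior_maximal hsub ho ⟨h0, h1, h2⟩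

theorem interior_refTri_nonempty : (interior refTri).Nonempty :=
  ⟨!₂[1 / 4, 1 / 4], mem_interior_refTri (by simp) (by simp) (by norm_num)⟩

theorem mem_frontier_of_mem_frontier_refTri {x : Plane} (hx : x ∈ frontier refTri) :
    x 0 = 0 ∨ x 1 = 0 ∨ x 0 + x 1 = 1 := by
  have hx' : x ∈ refTri := isCompact_refTri.isClosed.frontier_subset hx
  by_contra! h
  exact hx.2 (mem_interior_refTri (lt_of_le_of_ne hx'.1 (Ne.symm h.1))
    (lt_of_le_of_ne hx'.2.1 (Ne.symm h.2.1)) (lt_of_le_of_ne hx'.2.2 h.2.2))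

/-- The cubic bubble of the reference triangle. -/
def refBubble : MvPolynomial (Fin 2) ℝ := X 0 * X 1 * (1 - X 0 - X 1)

@[simp] theorem evalAt_refBubble (x : Plane) :
    evalAt refBubble x = x 0 * x 1 * (1 - x 0 - x 1) := by simp [refBubble]

/-- The bubble of degree four with the factor `α + β x + γ y`. -/
def refQuartic (α β γ : ℝ) : MvPolynomial (Fin 2) ℝ :=
  refBubble * (C α + C β * X 0 + C γ * X 1)

theorem evalAt_refQuartic (α β γ : ℝ) (x : Plane) : evalAt (refQuartic α β γ) x =
    x 0 * x 1 * (1 - x 0 - x 1) * (α + β * x 0 + γ * x 1) := by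
  simp [refQuartic]

theorem totalDegree_refQuartic_le (α β γ : ℝ) : (refQuartic α β γ).totalDegree ≤ 4 := by
  have hlin : ∀ Q ∈ ({X 0, X 1} : Set (MvPolynomial (Fin 2) ℝ)), Q.totalDegree ≤ 1 := by
    rintro Q (rfl | rfl) <;> simp
  have h1 : (1 - X 0 - X 1 : MvPolynomial (Fin 2) ℝ).totalDegree ≤ 1 :=
    (totalDegree_sub _ _).trans (max_le ((totalDegree_sub _ _).trans (by simp)) (by simp))
  have h2 : (C α + C β * X 0 + C γ * X 1 : MvPolynomial (Fin 2) ℝ).totalDegree ≤ 1 := by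
    refine (totalDegree_add _ _).trans (max_le ((totalDegree_add _ _).trans (max_le ?_ ?_)) ?_)
    · simp
    · exact (totalDegree_mul _ _).trans (by simp)
    · exact (totalDegree_mul _ _).trans (by simp)
  refine (totalDegree_mul _ _).trans (add_le_add (b := 3) (d := 1) ?_ h2)
  refine (totalDegree_mul _ _).trans (add_le_add (b := 2) (d := 1) ?_ h1)
  exact (totalDegree_mul _ _).trans (by simp)

/-- A quartic that vanishes on the frontier of the reference triangle is divisible by the
cubic bubble. -/
theorem exists_eq_refQuartic {P : MvPolynomial (Fin 2) ℝ} (hdeg : P.totalDegree ≤ 4)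
    (hP : ∀ x ∈ frontier refTri, evalAt P x = 0) : ∃ α β γ : ℝ, P = refQuartic α β γ := by
  obtain ⟨c, hc⟩ := exists_evalAt_eq_sum hdeg
  have h0 : ∀ s : ℝ, 0 ≤ s → s ≤ 1 → evalAt P !₂[0, s] = 0 := fun s h0 h1 =>
    hP _ (mem_frontier_refTri (by simp [mem_refTri, h0, h1]) (by simp))
  have h1 : ∀ s : ℝ, 0 ≤ s → s ≤ 1 → evalAt P !₂[s, 0] = 0 := fun s h0 h1 =>
    hP _ (mem_frontier_refTri (by simp [mem_refTri, h0, h1]) (by simp))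
  have h2 : ∀ s : ℝ, 0 ≤ s → s ≤ 1 → evalAt P !₂[s, 1 - s] = 0 := fun s h0 h1 =>
    hP _ (mem_frontier_refTri (by simp [mem_refTri, h0, h1]) (by simp))
  simp only [hc, Finset.sum_range_succ, Finset.range_zero,
    Finset.sum_empty, Matrix.cons_val_zero, Matrix.cons_val_one, Nat.reduceAdd,
    Nat.reduceSub, zero_add, pow_zero, mul_one] at h0 h1 h2
  have a0 := h0 0 (by norm_num) (by norm_num)
  have a1 := h0 (1 / 4) (by norm_num) (by norm_num)
  have a2 := h0 (1 / 2) (by norm_num) (by norm_num)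
  have a3 := h0 (3 / 4) (by norm_num) (by norm_num)
  have a4 := h0 1 (by norm_num) (by norm_num)
  have b1 := h1 (1 / 4) (by norm_num) (by norm_num)
  have b2 := h1 (1 / 2) (by norm_num) (by norm_num)
  have b3 := h1 (3 / 4) (by norm_num) (by norm_num)
  have b4 := h1 1 (by norm_num) (by norm_num)
  have d1 := h2 (1 / 4) (by norm_num) (by norm_num)
  have d2 := h2 (1 / 2) (by norm_num) (by norm_num)
  have d3 := h2 (3 / 4) (by norm_num) (by norm_num)
  norm_num at a0 a1 a2 a3 a4 b1 b2 b3 b4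
  have e00 : c 0 0 = 0 := by linarith
  have e01 : c 0 1 = 0 := by linarith
  have e02 : c 0 2 = 0 := by linarith
  have e03 : c 0 3 = 0 := by linarith
  have e04 : c 0 4 = 0 := by linarith
  have e10 : c 1 0 = 0 := by linarith
  have e20 : c 2 0 = 0 := by linarith
  have e30 : c 3 0 = 0 := by linarith
  have e40 : c 4 0 = 0 := by linarith
  rw [e00, e01, e02, e03, e04, e10, e20, e30, e40] at d1 d2 d3
  norm_num at d1 d2 d3
  have f12 : c 1 2 = -c 1 3 - c 1 1 := by linarith
  have f21 : c 2 1 = -c 3 1 - c 1 1 := by linarith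
  have f22 : c 2 2 = c 3 1 + c 1 3 := by linarith
  refine ⟨c 1 1, -c 3 1, -c 1 3, eq_of_evalAt_eq fun x => ?_⟩
  rw [evalAt_refQuartic, hc]
  simp only [Finset.sum_range_succ, Finset.range_zero, Finset.sum_empty,
    Nat.reduceAdd, Nat.reduceSub, e00, e01, e02, e03, e04, e10, e20, e30, e40, f12, f21, f22]
  ring

theorem evalAt_divPoly_refQuartic (a b : Fin 3 → ℝ) (x : Plane) :
    evalAt (divPoly ![refQuartic (a 0) (a 1) (a 2), refQuartic (b 0) (b 1) (b 2)]) x =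
      b 0 * x 0 + a 0 * x 1 + (b 1 - b 0) * x 0 ^ 2 + (a 2 - a 0) * x 1 ^ 2
      + 2 * (a 1 - a 0 + b 2 - b 0) * (x 0 * x 1) - b 1 * x 0 ^ 3 - a 2 * x 1 ^ 3
      - (3 * a 1 + 2 * b 1 + 2 * b 2) * (x 0 ^ 2 * x 1)
      - (2 * a 1 + 2 * a 2 + 3 * b 2) * (x 0 * x 1 ^ 2) := by
  simp [divPoly_apply, refQuartic, refBubble, pderiv_X]
  ring

theorem exists_eq_refQuartic_of_mem {P : Fin 2 → MvPolynomial (Fin 2) ℝ}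
    (hP : P ∈ bubblePoly refTri) : ∃ a b : Fin 3 → ℝ,
      P = ![refQuartic (a 0) (a 1) (a 2), refQuartic (b 0) (b 1) (b 2)] := by
  obtain ⟨α, β, γ, h0⟩ := exists_eq_refQuartic (hP 0).1 (hP 0).2
  obtain ⟨α', β', γ', h1⟩ := exists_eq_refQuartic (hP 1).1 (hP 1).2
  refine ⟨![α, β, γ], ![α', β', γ'], ?_⟩
  funext i
  fin_cases i
  · simpa using h0
  · simpa using h1

theorem refQuartic_mem (a b : Fin 3 → ℝ) :
    ![refQuartic (a 0) (a 1) (a 2), refQuartic (b 0) (b 1) (b 2)] ∈ bubblePoly refTri := by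
  have h : ∀ α β γ, (refQuartic α β γ).totalDegree ≤ 4 ∧
      ∀ x ∈ frontier refTri, evalAt (refQuartic α β γ) x = 0 := by
    refine fun α β γ => ⟨totalDegree_refQuartic_le α β γ, fun x hx => ?_⟩
    rw [evalAt_refQuartic]
    rcases mem_frontier_of_mem_frontier_refTri hx with h | h | h
    · simp [h]
    · simp [h]
    · rw [show 1 - x 0 - x 1 = 0 by linarith]; simp
  intro i
  fin_cases i
  · exact h _ _ _
  · exact h _ _ _

/-- A bubble field of degree four on the reference triangle without divergence is zero. -/
theorem eq_zero_of_divPoly_eq_zero_refTri {P : Fin 2 → MvPolynomial (Fin 2) ℝ}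
    (hP : P ∈ bubblePoly refTri) (h : divPoly P = 0) : P = 0 := by
  obtain ⟨a, b, rfl⟩ := exists_eq_refQuartic_of_mem hP
  have he : ∀ s t : ℝ, _ = (0 : ℝ) := fun s t =>
    (evalAt_divPoly_refQuartic a b !₂[s, t]).symm.trans (by rw [h, evalAt_zero])
  simp only [Matrix.cons_val_zero, Matrix.cons_val_one] at he
  have h1 := he 1 0
  have h2 := he (-1) 0
  have h3 := he 2 0
  have h4 := he 0 1
  have h5 := he 0 (-1)
  have h6 := he 0 2
  have h7 := he 1 1
  have h8 := he 1 (-1)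
  have h9 := he (-1) 1
  norm_num at h1 h2 h3 h4 h5 h6 h7 h8 h9
  have b0 : b 0 = 0 := by linarith
  have b1 : b 1 = 0 := by linarith
  have a0 : a 0 = 0 := by linarith
  have a2 : a 2 = 0 := by linarith
  have a1 : a 1 = 0 := by linarith
  have b2 : b 2 = 0 := by linarith
  funext i
  fin_cases i <;> simp [a0, a1, a2, b0, b1, b2, refQuartic]

/-- A cubic that vanishes at the vertices of the reference triangle is the sum of the divergence of
a bubble field and a multiple of the cubic bubble. -/
theorem exists_divPoly_add_refBubble {Q : MvPolynomial (Fin 2) ℝ} (hdeg : Q.totalDegree ≤ 3)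
    (h0 : evalAt Q !₂[0, 0] = 0) (h1 : evalAt Q !₂[1, 0] = 0) (h2 : evalAt Q !₂[0, 1] = 0) :
    ∃ P ∈ bubblePoly refTri, ∃ s : ℝ, Q = divPoly P + s • refBubble := by
  obtain ⟨c, hc⟩ := exists_evalAt_eq_sum hdeg
  simp [hc, Finset.sum_range_succ] at h0 h1 h2
  -- comparison of coefficients: six of the unknowns are the coefficients of the field
  let A := c 1 1 + 2 * c 0 1 + 2 * c 1 0
  let B := -c 2 1 + 2 * c 3 0
  let D := -c 1 2 + 2 * c 0 3
  refine ⟨_, refQuartic_mem ![c 0 1, B - A, -c 0 3] ![c 1 0, -c 3 0, D - A],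
    5 * A - 2 * B - 2 * D, eq_of_evalAt_eq fun x => ?_⟩
  rw [evalAt_add, evalAt_smul, evalAt_divPoly_refQuartic, evalAt_refBubble, hc]
  have e2 : c 2 0 = -c 3 0 - c 1 0 := by linarith
  have e3 : c 0 2 = -c 0 3 - c 0 1 := by linarith
  simp [Finset.sum_range_succ, e2, e3, h0, A, B, D]
  ring

/-- On the reference triangle the gradient of a bubble field is controlled by its divergence. -/
theorem exists_refTri_gradient_le : ∃ C : ℝ, 0 ≤ C ∧ ∀ P ∈ bubblePoly refTri,
    ∫ x in refTri, ∑ i, ∑ j, evalAt (pderiv j (P i)) x ^ 2 ≤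
      C * ∫ x in refTri, evalAt (divPoly P) x ^ 2 := by
  let d : bubblePoly refTri →ₗ[ℝ] MvPolynomial (Fin 2) ℝ := divPoly ∘ₗ (bubblePoly refTri).subtype
  let D : Fin 2 → Fin 2 → bubblePoly refTri →ₗ[ℝ] MvPolynomial (Fin 2) ℝ := fun i j =>
    (pderiv j).toLinearMap ∘ₗ LinearMap.proj i ∘ₗ (bubblePoly refTri).subtype
  let F := l2Form isCompact_refTri
  obtain ⟨C, hC, h⟩ := exists_forall_apply_self_le (F.compl₁₂ d d)
    (∑ i, ∑ j, F.compl₁₂ (D i j) (D i j))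
    (fun _ _ => l2Form_comm isCompact_refTri _ _)
    (fun _ => l2Form_self_nonneg isCompact_refTri _) (fun P hP => by
      have := eq_zero_of_l2Form_self isCompact_refTri interior_refTri_nonempty hP
      exact Subtype.ext (eq_zero_of_divPoly_eq_zero_refTri P.2 this))
  refine ⟨C, hC, fun P hP => ?_⟩
  have hi : ∀ i j, Integrable (fun x => evalAt (pderiv j (P i)) x ^ 2)
      (volume.restrict refTri) := fun i j => integrable_evalAt_sq isCompact_refTri _
  rw [integral_finsetSum _ fun i _ => integrable_finsetSum _ fun j _ => hi i j]
  simp_rw [integral_finsetSum _ fun j _ => hi _ j]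
  have := h ⟨P, hP⟩
  simpa [F, D, d, sq] using this

/-! ### Triangles as affine images of the reference triangle -/

theorem isCompact_tri (K : Finset Plane) : IsCompact (tri K) :=
  K.finite_toSet.isCompact_convexHull ℝ

theorem measurableSet_tri (K : Finset Plane) : MeasurableSet (tri K) :=
  (isCompact_tri K).measurableSet

/-- The affine map `x ↦ M x + t` is invertible and takes the reference triangle and its vertices to
the triangle `K` and its vertices. -/
structure IsParam (K : Finset Plane) (M : Matrix (Fin 2) (Fin 2) ℝ) (t : Plane) : Prop where
  det_ne_zero : M.det ≠ 0
  image_eq : affMap M t '' refTri = tri K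
  vertices_eq : (K : Set Plane) = {affMap M t !₂[0, 0], affMap M t !₂[1, 0], affMap M t !₂[0, 1]}

theorem image_affMap_refTri (M : Matrix (Fin 2) (Fin 2) ℝ) (t : Plane) :
    affMap M t '' refTri =
      convexHull ℝ {affMap M t !₂[0, 0], affMap M t !₂[1, 0], affMap M t !₂[0, 1]} := by
  have hcomb : ∀ x, affMap M t x = (1 - x 0 - x 1) • affMap M t !₂[0, 0] +
      x 0 • affMap M t !₂[1, 0] + x 1 • affMap M t !₂[0, 1] := by
    intro x
    ext i
    simp only [affMap_apply, PiLp.add_apply, PiLp.smul_apply, Fin.sum_univ_two, smul_eq_mul]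
    simp
    ring
  refine Set.Subset.antisymm ?_ (convexHull_min ?_ ?_)
  · rintro _ ⟨x, ⟨h0, h1, h2⟩, rfl⟩
    rw [hcomb x]
    set s : Set Plane := {affMap M t !₂[0, 0], affMap M t !₂[1, 0], affMap M t !₂[0, 1]}
    have hs : Convex ℝ (convexHull ℝ s) := convex_convexHull ℝ s
    have := hs.sum_mem (t := Finset.univ) (w := ![1 - x 0 - x 1, x 0, x 1])
      (z := ![affMap M t !₂[0, 0], affMap M t !₂[1, 0], affMap M t !₂[0, 1]])
      (fun i _ => by fin_cases i <;> simp <;> linarith)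
      (by simp [Fin.sum_univ_three]; ring) (fun i _ => subset_convexHull ℝ s (by
        fin_cases i <;> simp [s]))
    simpa [Fin.sum_univ_three] using this
  · rintro _ (rfl | rfl | rfl) <;> refine Set.mem_image_of_mem _ ?_ <;> simp [mem_refTri]
  · have h := (convex_refTri.linear_image (Matrix.toEuclideanLin M)).translate t
    rw [Set.image_image] at h
    rwa [show affMap M t = fun x => t + Matrix.toEuclideanLin M x from
      funext fun x => add_comm _ _]

/-- A triangle whose angles are at least `ϑ` is the image of the reference triangle under an
affine map whose condition number is bounded in terms of `ϑ`. -/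
theorem exists_isParam {ϑ : ℝ} (hϑ : 0 < ϑ) {K : Finset Plane} (hcard : K.card = 3)
    (hangle : ∀ a ∈ K, ∀ b ∈ K, ∀ c ∈ K, a ≠ b → b ≠ c → a ≠ c →
      ϑ ≤ EuclideanGeometry.angle a b c) :
    ∃ M t, IsParam K M t ∧ (∑ i, ∑ j, M i j ^ 2) ^ 2 ≤ 4 / Real.sin ϑ ^ 4 * M.det ^ 2 := by
  obtain ⟨a, b, c, hab, hac, hbc, rfl⟩ := Finset.card_eq_three.mp hcard
  have hA := hangle b (by simp) a (by simp) c (by simp) hab.symm hac hbc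
  have hB := hangle c (by simp) b (by simp) a (by simp) hbc.symm hab.symm hac.symm
  have hC := hangle a (by simp) c (by simp) b (by simp) hac hbc.symm hab
  have hsum := EuclideanGeometry.angle_add_angle_add_angle_eq_pi c hab.symm
  -- all angles lie between `ϑ` and `π - ϑ`, where the sine is at least `sin ϑ`
  have hsin : ∀ α : ℝ, ϑ ≤ α → α ≤ Real.pi - ϑ → Real.sin ϑ ≤ Real.sin α := by
    intro α h1 h2
    rcases le_total α (Real.pi / 2) with h | h
    · exact Real.sin_le_sin_of_le_of_le_pi_div_two (by linarith) h h1
    · rw [← Real.sin_pi_sub α]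
      exact Real.sin_le_sin_of_le_of_le_pi_div_two (by linarith) (by linarith) (by linarith)
  rw [EuclideanGeometry.angle_comm a b c, EuclideanGeometry.angle_comm b c a,
    EuclideanGeometry.angle_comm c a b] at hsum
  have hs : 0 < Real.sin ϑ := Real.sin_pos_of_pos_of_lt_pi hϑ (by linarith)
  have hsA := hsin _ hA (by linarith)
  have hsB := hsin _ hB (by linarith)
  have hsC := hsin _ hC (by linarith)
  have law := EuclideanGeometry.sin_angle_mul_dist_eq_sin_angle_mul_dist c b a
  -- the columns of `M` are the edges that start in `a`
  let M : Matrix (Fin 2) (Fin 2) ℝ := Matrix.of fun i j => (![b - a, c - a] j) i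
  have hdet : M.det ^ 2 = (dist b a * dist c a * Real.sin (EuclideanGeometry.angle b a c)) ^ 2 := by
    have hcos := InnerProductGeometry.cos_angle_mul_norm_mul_norm (b - a) (c - a)
    have hsq := Real.sin_sq_add_cos_sq (EuclideanGeometry.angle b a c)
    have hn : ∀ v : Plane, ‖v‖ ^ 2 = v 0 ^ 2 + v 1 ^ 2 := fun v => by
      rw [EuclideanSpace.real_norm_sq_eq, Fin.sum_univ_two]
    have hin : inner ℝ (b - a) (c - a)
        = (b - a) 0 * (c - a) 0 + (b - a) 1 * (c - a) 1 := by
      simp [PiLp.inner_apply, Fin.sum_univ_two]; ring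
    have hang : InnerProductGeometry.angle (b - a) (c - a) = EuclideanGeometry.angle b a c := rfl
    rw [hang, hin] at hcos
    have hprod : (‖b - a‖ * ‖c - a‖ * Real.sin (EuclideanGeometry.angle b a c)) ^ 2 =
        ‖b - a‖ ^ 2 * ‖c - a‖ ^ 2 -
          (Real.cos (EuclideanGeometry.angle b a c) * (‖b - a‖ * ‖c - a‖)) ^ 2 := by
      linear_combination ‖b - a‖ ^ 2 * ‖c - a‖ ^ 2 * hsq
    rw [dist_eq_norm, dist_eq_norm, hprod, hcos, hn, hn, Matrix.det_fin_two]
    simp [M]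
    ring
  have hM0 : M.det ≠ 0 := by
    have hpos : 0 < dist b a * dist c a * Real.sin (EuclideanGeometry.angle b a c) :=
      mul_pos (mul_pos (dist_pos.mpr hab.symm) (dist_pos.mpr hac.symm)) (hs.trans_le hsA)
    intro h0
    rw [h0] at hdet
    have := pow_pos hpos 2
    rw [← hdet] at this
    norm_num at this
  have h00 : affMap M a !₂[0, 0] = a := by ext i; simp [affMap_apply]
  have h10 : affMap M a !₂[1, 0] = b := by ext i; simp [affMap_apply, M]
  have h01 : affMap M a !₂[0, 1] = c := by ext i; simp [affMap_apply, M]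
  refine ⟨M, a, ⟨hM0, ?_, ?_⟩, ?_⟩
  · rw [image_affMap_refTri, h00, h10, h01, tri]
    simp
  · rw [h00, h10, h01]
    simp
  · have hF : ∑ i, ∑ j, M i j ^ 2 = dist b a ^ 2 + dist c a ^ 2 := by
      rw [dist_eq_norm, dist_eq_norm, EuclideanSpace.real_norm_sq_eq,
        EuclideanSpace.real_norm_sq_eq]
      simp [M, Fin.sum_univ_two]
      ring
    rw [hF, hdet]
    -- two adjacent sides are comparable by the law of sines
    rw [dist_comm a c] at law
    set x := dist b a
    set y := dist c a
    set s := Real.sin ϑ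
    set σ := Real.sin (EuclideanGeometry.angle b a c)
    have hx : 0 < x := dist_pos.mpr hab.symm
    have hy : 0 < y := dist_pos.mpr hac.symm
    have h1 : s * x ≤ y := by
      calc s * x ≤ Real.sin (EuclideanGeometry.angle c b a) * x :=
            mul_le_mul_of_nonneg_right hsB hx.le
        _ = Real.sin (EuclideanGeometry.angle a c b) * y := law
        _ ≤ 1 * y := mul_le_mul_of_nonneg_right (Real.sin_le_one _) hy.le
        _ = y := one_mul y
    have h2 : s * y ≤ x := by
      calc s * y ≤ Real.sin (EuclideanGeometry.angle a c b) * y :=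
            mul_le_mul_of_nonneg_right hsC hy.le
        _ = Real.sin (EuclideanGeometry.angle c b a) * x := law.symm
        _ ≤ 1 * x := mul_le_mul_of_nonneg_right (Real.sin_le_one _) hx.le
        _ = x := one_mul x
    have h3 : s * (x ^ 2 + y ^ 2) ≤ 2 * (x * y) := by nlinarith
    have h4 : s * s * (x ^ 2 + y ^ 2) ≤ 2 * (x * y * σ) := by
      have e1 : s * (s * (x ^ 2 + y ^ 2)) ≤ s * (2 * (x * y)) := mul_le_mul_of_nonneg_left h3 hs.le
      have e2 : s * (2 * (x * y)) ≤ σ * (2 * (x * y)) :=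
        mul_le_mul_of_nonneg_right hsA (by positivity)
      linarith
    rw [div_mul_eq_mul_div, le_div_iff₀ (by positivity)]
    have h5 := pow_le_pow_left₀ (by positivity) h4 2
    calc (x ^ 2 + y ^ 2) ^ 2 * s ^ 4 = (s * s * (x ^ 2 + y ^ 2)) ^ 2 := by ring
      _ ≤ (2 * (x * y * σ)) ^ 2 := h5
      _ = _ := by ring

namespace IsParam

variable {K : Finset Plane} {M : Matrix (Fin 2) (Fin 2) ℝ} {t : Plane}

theorem interior_nonempty (h : IsParam K M t) : (interior (tri K)).Nonempty := by
  rw [← h.image_eq, interior_image_affMap h.det_ne_zero]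
  exact interior_refTri_nonempty.image _

theorem piola_mem (h : IsParam K M t) {P : Fin 2 → MvPolynomial (Fin 2) ℝ}
    (hP : P ∈ bubblePoly (tri K)) : piola M t P ∈ bubblePoly refTri := by
  refine piola_mem_bubblePoly (fun x hx => ?_) hP
  rw [← h.image_eq, frontier_image_affMap h.det_ne_zero]
  exact Set.mem_image_of_mem _ hx

theorem eq_zero_of_divPoly_eq_zero (h : IsParam K M t) {P : Fin 2 → MvPolynomial (Fin 2) ℝ}
    (hP : P ∈ bubblePoly (tri K)) (hdiv : divPoly P = 0) : P = 0 := by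
  have h0 : piola M t P = 0 := eq_zero_of_divPoly_eq_zero_refTri (h.piola_mem hP) (by
    rw [divPoly_piola, hdiv, map_zero, smul_zero])
  have h1 : ∀ k, ∑ i, M.adjugate k i • P i = 0 := fun k => by
    refine affSubst_injective (t := t) h.det_ne_zero ?_
    simpa [piola] using congrFun h0 k
  have e0 := h1 0
  have e1 := h1 1
  simp only [Matrix.adjugate_fin_two, Fin.sum_univ_two] at e0 e1
  simp at e0 e1
  have e0' : ∀ x, M 1 1 * evalAt (P 0) x - M 0 1 * evalAt (P 1) x = 0 := fun x => by
    simpa [sub_eq_add_neg] using congrArg (fun R => evalAt R x) e0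
  have e1' : ∀ x, -(M 1 0 * evalAt (P 0) x) + M 0 0 * evalAt (P 1) x = 0 := fun x => by
    simpa using congrArg (fun R => evalAt R x) e1
  have d0 : M.det • P 0 = 0 := eq_of_evalAt_eq fun x => by
    rw [Matrix.det_fin_two, evalAt_smul, evalAt_zero]
    linear_combination M 0 0 * e0' x + M 0 1 * e1' x
  have d1 : M.det • P 1 = 0 := eq_of_evalAt_eq fun x => by
    rw [Matrix.det_fin_two, evalAt_smul, evalAt_zero]
    linear_combination M 1 0 * e0' x + M 1 1 * e1' x
  funext i
  fin_cases i
  · exact (smul_eq_zero.mp d0).resolve_left h.det_ne_zero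
  · exact (smul_eq_zero.mp d1).resolve_left h.det_ne_zero

/-- The gradient of a bubble field vanishes at the vertices, hence so does its divergence. -/
theorem evalAt_divPoly_vertex (h : IsParam K M t) {P : Fin 2 → MvPolynomial (Fin 2) ℝ}
    (hP : P ∈ bubblePoly (tri K)) {V : Plane} (hV : V ∈ K) : evalAt (divPoly P) V = 0 := by
  obtain ⟨a, b, hab⟩ := exists_eq_refQuartic_of_mem (h.piola_mem hP)
  have key : ∀ x, M.det * evalAt (divPoly P) (affMap M t x) = _ := fun x => by
    rw [← evalAt_affSubst, ← evalAt_smul, ← divPoly_piola, hab, evalAt_divPoly_refQuartic]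
  have hV' : V ∈ (K : Set Plane) := hV
  rw [h.vertices_eq] at hV'
  refine (mul_eq_zero.mp ?_).resolve_left h.det_ne_zero
  rcases hV' with rfl | rfl | rfl <;> rw [key] <;> simp

/-- A cubic with mean value zero that vanishes at the vertices is the divergence of a bubble
field. -/
theorem exists_divPoly_eq (h : IsParam K M t) {Q : MvPolynomial (Fin 2) ℝ}
    (hdeg : Q.totalDegree ≤ 3) (hV : ∀ V ∈ K, evalAt Q V = 0)
    (hint : ∫ x in tri K, evalAt Q x = 0) :
    ∃ P ∈ bubblePoly (tri K), Q = divPoly P := by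
  have hV' : ∀ V ∈ (K : Set Plane), evalAt Q V = 0 := hV
  rw [h.vertices_eq] at hV'
  obtain ⟨P, hP, s, hs⟩ := exists_divPoly_add_refBubble
    ((totalDegree_affSubst_le M t Q).trans hdeg)
    (by rw [evalAt_affSubst]; exact hV' _ (by simp))
    (by rw [evalAt_affSubst]; exact hV' _ (by simp))
    (by rw [evalAt_affSubst]; exact hV' _ (by simp))
  let P' := M.det • piola M⁻¹ (invShift M t) P
  let b := affSubst M⁻¹ (invShift M t) refBubble
  have hP' : P' ∈ bubblePoly (tri K) := by
    refine Submodule.smul_mem _ _ (piola_mem_bubblePoly (fun x hx => ?_) hP)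
    rw [← h.image_eq, frontier_image_affMap h.det_ne_zero] at hx
    obtain ⟨y, hy, rfl⟩ := hx
    rwa [affMap_inv_affMap h.det_ne_zero]
  have hQ : Q = divPoly P' + s • b := by
    rw [map_smul, divPoly_piola, smul_smul, Matrix.det_nonsing_inv, Ring.inverse_eq_inv',
      mul_inv_cancel₀ h.det_ne_zero, one_smul, ← map_smul, ← map_add, ← hs,
      affSubst_inv_affSubst h.det_ne_zero]
  have hi := integrable_evalAt (isCompact_tri K)
  -- the bubble has positive mean value, so it does not contribute
  have hs0 : s = 0 := by
    have h1 : s * ∫ x in tri K, evalAt b x = 0 := by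
      rw [← hint, hQ]
      simp only [evalAt_add, evalAt_smul]
      rw [integral_add (hi _) ((hi b).const_mul s), setIntegral_divPoly (isCompact_tri K) hP',
        zero_add, integral_const_mul]
    refine (mul_eq_zero.mp h1).resolve_right fun h2 => ?_
    have hb : 0 ≤ᵐ[volume.restrict (tri K)] evalAt b := by
      refine (ae_restrict_iff' (measurableSet_tri K)).mpr (Eventually.of_forall fun x hx => ?_)
      rw [← h.image_eq] at hx
      obtain ⟨y, hy, rfl⟩ := hx
      rw [evalAt_affSubst, affMap_inv_affMap h.det_ne_zero, evalAt_refBubble]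
      exact mul_nonneg (mul_nonneg hy.1 hy.2.1) (by linarith [hy.2.2])
    rw [integral_eq_zero_iff_of_nonneg_ae hb (hi b)] at h2
    have h3 : b = 0 := eq_of_evalAt_ae_eq h.interior_nonempty (by
      filter_upwards [h2] with x hx
      simpa using hx)
    have h4 : refBubble = 0 := by
      rw [← affSubst_affSubst_inv (t := t) h.det_ne_zero refBubble]
      exact (congrArg _ h3).trans (map_zero _)
    have h5 := evalAt_refBubble !₂[1 / 4, 1 / 4]
    rw [h4] at h5
    norm_num at h5
  exact ⟨P', hP', by rw [hQ, hs0, zero_smul, add_zero]⟩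

/-- The gradient of a bubble field is controlled by its divergence, by a transformation to the
reference triangle. -/
theorem gradient_le (h : IsParam K M t) {C κ : ℝ}
    (hCle : ∀ P ∈ bubblePoly refTri,
      ∫ x in refTri, ∑ i, ∑ j, evalAt (pderiv j (P i)) x ^ 2 ≤
        C * ∫ x in refTri, evalAt (divPoly P) x ^ 2)
    (hκ : (∑ i, ∑ j, M i j ^ 2) ^ 2 ≤ κ * M.det ^ 2)
    {P : Fin 2 → MvPolynomial (Fin 2) ℝ} (hP : P ∈ bubblePoly (tri K)) :
    ∫ x in tri K, ∑ i, ∑ j, evalAt (pderiv j (P i)) x ^ 2 ≤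
      C * κ * ∫ x in tri K, evalAt (divPoly P) x ^ 2 := by
  obtain ⟨δ, hδ, hint⟩ := exists_setIntegral_image_affMap h.det_ne_zero t
  rw [← h.image_eq, hint isCompact_refTri.measurableSet, hint isCompact_refTri.measurableSet,
    mul_left_comm]
  refine mul_le_mul_of_nonneg_left ?_ hδ
  have hsq := integrable_evalAt_sq isCompact_refTri
  have h1 : M.det ^ 4 * ∫ x in refTri, ∑ i, ∑ j, evalAt (pderiv j (P i)) (affMap M t x) ^ 2 ≤
      (∑ i, ∑ j, M i j ^ 2) ^ 2 *
        ∫ x in refTri, ∑ k, ∑ l, evalAt (pderiv l (piola M t P k)) x ^ 2 := by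
    rw [← integral_const_mul, ← integral_const_mul]
    refine integral_mono ?_ ?_ fun x => sum_sq_pderiv_le P x
    · refine Integrable.const_mul (integrable_finsetSum _ fun i _ =>
        integrable_finsetSum _ fun j _ => ?_) _
      simpa only [evalAt_affSubst] using hsq (affSubst M t (pderiv j (P i)))
    · exact Integrable.const_mul (integrable_finsetSum _ fun i _ =>
        integrable_finsetSum _ fun j _ => hsq _) _
  have h2 := hCle _ (h.piola_mem hP)
  have h3 : ∫ x in refTri, evalAt (divPoly (piola M t P)) x ^ 2 =
      M.det ^ 2 * ∫ x in refTri, evalAt (divPoly P) (affMap M t x) ^ 2 := by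
    simp only [divPoly_piola, evalAt_smul, evalAt_affSubst, mul_pow, integral_const_mul]
  rw [h3] at h2
  set I := ∫ x in refTri, evalAt (divPoly P) (affMap M t x) ^ 2
  set G := ∫ x in refTri, ∑ k, ∑ l, evalAt (pderiv l (piola M t P k)) x ^ 2
  set J := ∫ x in refTri, ∑ i, ∑ j, evalAt (pderiv j (P i)) (affMap M t x) ^ 2
  have hI : 0 ≤ I := integral_nonneg fun _ => sq_nonneg _
  have h4 : M.det ^ 4 * J ≤ (κ * M.det ^ 2) * (C * (M.det ^ 2 * I)) :=
    h1.trans (mul_le_mul hκ h2 (integral_nonneg fun _ => Finset.sum_nonneg fun _ _ =>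
      Finset.sum_nonneg fun _ _ => sq_nonneg _) ((sq_nonneg _).trans hκ))
  have h5 : M.det ^ 4 * J ≤ M.det ^ 4 * (C * κ * I) := by
    calc _ ≤ _ := h4
      _ = _ := by ring
  exact le_of_mul_le_mul_left h5 (by have := h.det_ne_zero; positivity)

end IsParam

/-! ### Sting functions and the decomposition of cubics on a triangle -/

/-- The extension by zero of the restriction of a polynomial to the triangle `K`. -/
def restr (K : Finset Plane) : MvPolynomial (Fin 2) ℝ →ₗ[ℝ] Plane → ℝ where
  toFun P := (tri K).indicator (evalAt P)
  map_add' P Q := by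
    ext x
    by_cases hx : x ∈ tri K <;> simp [hx]
  map_smul' c P := by
    ext x
    by_cases hx : x ∈ tri K <;> simp [hx]

theorem restr_apply (K : Finset Plane) (P : MvPolynomial (Fin 2) ℝ) :
    restr K P = (tri K).indicator (evalAt P) := rfl

theorem restr_ae_eq (K : Finset Plane) (P : MvPolynomial (Fin 2) ℝ) :
    restr K P =ᵐ[volume.restrict (tri K)] evalAt P := by
  filter_upwards [self_mem_ae_restrict (measurableSet_tri K)] with x hx
  exact Set.indicator_of_mem hx _

/-- The polynomials that represent the sting functions of `K`. -/
def stingPoly (K : Finset Plane) : Set (MvPolynomial (Fin 2) ℝ) :=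
  {s | s.totalDegree ≤ 3 ∧ ∃ V ∈ K, ∀ P : MvPolynomial (Fin 2) ℝ, P.totalDegree ≤ 3 →
    l2Form (isCompact_tri K) s P = volume.real (tri K) / 100 * evalAt P V}

theorem isSting_restr_iff {K : Finset Plane} {V : Plane} {s : MvPolynomial (Fin 2) ℝ}
    (hs : s.totalDegree ≤ 3) : IsSting K V (restr K s) ↔
      ∀ P : MvPolynomial (Fin 2) ℝ, P.totalDegree ≤ 3 →
        l2Form (isCompact_tri K) s P = volume.real (tri K) / 100 * evalAt P V := by
  have h : ∀ P : MvPolynomial (Fin 2) ℝ, ∫ x in tri K, restr K s x * evalAt P x =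
      l2Form (isCompact_tri K) s P := fun P => by
    refine integral_congr_ae ?_
    filter_upwards [restr_ae_eq K s] with x hx
    rw [hx]
  simp only [IsSting, h]
  exact and_iff_right ⟨s, hs, rfl⟩

theorem stingSpace_eq (K : Finset Plane) :
    stingSpace K = restr K '' (Submodule.span ℝ (stingPoly K) : Set (MvPolynomial (Fin 2) ℝ)) := by
  have : {s | ∃ V ∈ K, IsSting K V s} = restr K '' stingPoly K := by
    ext r
    constructor
    · rintro ⟨V, hV, hr⟩
      obtain ⟨s, hs, rfl⟩ := hr.1
      exact ⟨s, ⟨hs, V, hV, (isSting_restr_iff hs).mp hr⟩, rfl⟩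
    · rintro ⟨s, ⟨hs, V, hV, h⟩, rfl⟩
      exact ⟨V, hV, (isSting_restr_iff hs).mpr h⟩
  rw [stingSpace, this, Submodule.span_image, Submodule.map_coe]

theorem mem_constSpace {K : Finset Plane} {r : Plane → ℝ} :
    r ∈ constSpace K ↔ ∃ c : ℝ, r = restr K (C c) := by
  have h : ∀ c : ℝ, restr K (C c) = c • (tri K).indicator fun _ => (1 : ℝ) := fun c => by
    ext x
    by_cases hx : x ∈ tri K <;> simp [restr_apply, hx]
  rw [constSpace, SetLike.mem_coe, Submodule.mem_span_singleton]
  simp only [h, eq_comm]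

theorem l2Form_const_divPoly {K : Finset Plane} (c : ℝ) {P : Fin 2 → MvPolynomial (Fin 2) ℝ}
    (hP : P ∈ bubblePoly (tri K)) : l2Form (isCompact_tri K) (C c) (divPoly P) = 0 := by
  simp only [l2Form_apply, evalAt_C]
  rw [integral_const_mul, setIntegral_divPoly (isCompact_tri K) hP, mul_zero]

namespace IsParam

variable {K : Finset Plane} {M : Matrix (Fin 2) (Fin 2) ℝ} {t : Plane}

theorem volume_real_pos (h : IsParam K M t) : 0 < volume.real (tri K) :=
  ENNReal.toReal_pos (Measure.measure_pos_of_nonempty_interior _ h.interior_nonempty).ne'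
    (isCompact_tri K).measure_lt_top.ne

/-- The divergence of a bubble field is orthogonal to the sting functions, since it vanishes at
the vertices. -/
theorem l2Form_sting_divPoly (h : IsParam K M t) {z : MvPolynomial (Fin 2) ℝ}
    (hz : z ∈ Submodule.span ℝ (stingPoly K)) {P : Fin 2 → MvPolynomial (Fin 2) ℝ}
    (hP : P ∈ bubblePoly (tri K)) : l2Form (isCompact_tri K) z (divPoly P) = 0 := by
  induction hz using Submodule.span_induction with
  | mem s hs =>
    obtain ⟨-, V, hV, hs⟩ := hs
    rw [hs _ (totalDegree_divPoly_le hP), h.evalAt_divPoly_vertex hP hV, mul_zero]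
  | zero => simp
  | add x y _ _ hx hy => rw [map_add, LinearMap.add_apply, hx, hy, add_zero]
  | smul c x _ hx => rw [map_smul, LinearMap.smul_apply, hx, smul_zero]

theorem exists_stingPoly (h : IsParam K M t) (V : Plane) (hV : V ∈ K) :
    ∃ s ∈ stingPoly K, ∀ P : MvPolynomial (Fin 2) ℝ, P.totalDegree ≤ 3 →
      l2Form (isCompact_tri K) s P = volume.real (tri K) / 100 * evalAt P V := by
  let W := restrictTotalDegree (Fin 2) ℝ 3
  let l : MvPolynomial (Fin 2) ℝ →ₗ[ℝ] ℝ :=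
    { toFun := fun P => volume.real (tri K) / 100 * evalAt P V
      map_add' := fun P Q => by simp only [evalAt_add, mul_add]
      map_smul' := fun c P => by simp only [evalAt_smul, RingHom.id_apply, smul_eq_mul]; ring }
  obtain ⟨s, hs⟩ := exists_forall_apply_eq
    ((l2Form (isCompact_tri K)).compl₁₂ W.subtype W.subtype)
    (fun u hu => Subtype.ext (eq_zero_of_l2Form_self (isCompact_tri K) h.interior_nonempty hu))
    (l ∘ₗ W.subtype)
  have hs' : ∀ P : MvPolynomial (Fin 2) ℝ, P.totalDegree ≤ 3 →
      l2Form (isCompact_tri K) s P = volume.real (tri K) / 100 * evalAt P V := fun P hP =>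
    hs ⟨P, (mem_restrictTotalDegree _ _ _).mpr hP⟩
  exact ⟨s, ⟨(mem_restrictTotalDegree _ _ _).mp s.2, V, hV, hs'⟩, hs'⟩

/-- Every cubic is the sum of the divergence of a bubble field, of sting functions and of a
constant: a cubic that is orthogonal to the sting functions and to the constants vanishes at the
vertices and has mean value zero. -/
theorem exists_decomposition (h : IsParam K M t) {Q : MvPolynomial (Fin 2) ℝ}
    (hQ : Q.totalDegree ≤ 3) : ∃ P ∈ bubblePoly (tri K),
      ∃ z ∈ Submodule.span ℝ (stingPoly K), ∃ c : ℝ, Q = divPoly P + z + C c := by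
  have hK := isCompact_tri K
  let W := restrictTotalDegree (Fin 2) ℝ 3
  let U := Submodule.span ℝ (insert (C 1) (stingPoly K))
  have hUW : U ≤ W := by
    refine Submodule.span_le.mpr ?_
    rintro s (rfl | hs)
    · exact (mem_restrictTotalDegree _ _ _).mpr (by simp)
    · exact (mem_restrictTotalDegree _ _ _).mpr hs.1
  have : FiniteDimensional ℝ U := Submodule.finiteDimensional_of_le hUW
  -- the orthogonal projection of `Q` to the span of the sting functions and the constants
  obtain ⟨⟨u, hu⟩, hproj⟩ := exists_forall_apply_eq ((l2Form hK).compl₁₂ U.subtype U.subtype)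
    (fun u hu => Subtype.ext (eq_zero_of_l2Form_self hK h.interior_nonempty hu))
    (l2Form hK Q ∘ₗ U.subtype)
  have horth : ∀ w ∈ U, l2Form hK w (Q - u) = 0 := fun w hw => by
    have : l2Form hK u w = l2Form hK Q w := hproj ⟨w, hw⟩
    rw [l2Form_comm, map_sub, LinearMap.sub_apply, this, sub_self]
  have hdeg : (Q - u).totalDegree ≤ 3 := by
    have := W.sub_mem ((mem_restrictTotalDegree _ _ _).mpr hQ) (hUW hu)
    exact (mem_restrictTotalDegree _ _ _).mp this
  obtain ⟨P, hP, hPQ⟩ := h.exists_divPoly_eq hdeg (fun V hV => by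
    obtain ⟨s, hs, hsV⟩ := h.exists_stingPoly V hV
    have h0 := horth s (Submodule.subset_span (Set.mem_insert_of_mem _ hs))
    rw [hsV _ hdeg] at h0
    exact (mul_eq_zero.mp h0).resolve_left (by have := h.volume_real_pos; positivity)) (by
    have h0 := horth (C 1) (Submodule.subset_span (Set.mem_insert _ _))
    simpa only [l2Form_apply, evalAt_C, one_mul] using h0)
  obtain ⟨c, z, hz, rfl⟩ := Submodule.mem_span_insert.mp hu
  refine ⟨P, hP, z, hz, c, ?_⟩
  rw [← hPQ, smul_eq_C_mul, ← C_mul, mul_one]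
  ring

end IsParam

/-! ### Triangulations -/

theorem volume_segment (a b : Plane) : volume (segment ℝ a b) = 0 := by
  have hsub : segment ℝ a b ⊆ (affineSpan ℝ {a, b} : Set Plane) := by
    rw [← convexHull_pair]
    exact convexHull_subset_affineSpan _
  refine measure_mono_null hsub (Measure.addHaar_affineSubspace _ _ fun htop => ?_)
  have h1 := (collinear_pair ℝ a b).finrank_le_one
  have h2 : vectorSpan ℝ {a, b} = ⊤ := by
    rw [← direction_affineSpan, htop, AffineSubspace.direction_top]
  rw [h2, finrank_top, finrank_euclideanSpace_fin] at h1
  norm_num at h1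

section Triangulation

variable {Ω : Set Plane} {T : Finset (Finset Plane)}

theorem IsTriangulation.volume_inter (hT : IsTriangulation Ω T) {K K' : Finset Plane} (hK : K ∈ T)
    (hK' : K' ∈ T) (hne : K ≠ K') : volume (tri K ∩ tri K') = 0 := by
  classical
  rw [hT.conforming K hK K' hK', ← Finset.coe_inter]
  have hlt : (K ∩ K').card < 3 := by
    rw [← hT.card_eq K hK]
    refine Finset.card_lt_card (Finset.ssubset_iff_subset_ne.mpr
      ⟨Finset.inter_subset_left, fun h => hne ?_⟩)
    exact Finset.eq_of_subset_of_card_le (Finset.inter_eq_left.mp h)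
      (by rw [hT.card_eq K hK, hT.card_eq K' hK'])
  have hpair : ∃ a b, K ∩ K' ⊆ {a, b} := by
    interval_cases h : (K ∩ K').card
    · rw [Finset.card_eq_zero] at h
      exact ⟨0, 0, by simp [h]⟩
    · obtain ⟨a, ha⟩ := Finset.card_eq_one.mp h
      exact ⟨a, a, by simp [ha]⟩
    · obtain ⟨a, b, -, hab⟩ := Finset.card_eq_two.mp h
      exact ⟨a, b, hab.subset⟩
  obtain ⟨a, b, hab⟩ := hpair
  refine measure_mono_null (convexHull_mono (Finset.coe_subset.mpr hab)) ?_
  rw [Finset.coe_pair, convexHull_pair, volume_segment]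

theorem IsTriangulation.tri_subset (hT : IsTriangulation Ω T) {K : Finset Plane} (hK : K ∈ T) :
    tri K ⊆ closure Ω := by
  rw [← hT.cover]
  exact Set.subset_biUnion_of_mem (u := fun K => tri K) hK

theorem IsTriangulation.interior_tri_subset (hΩ : IsPolygonalDomain Ω) (hT : IsTriangulation Ω T)
    {K : Finset Plane} (hK : K ∈ T) : interior (tri K) ⊆ Ω := by
  rw [← hΩ.interior_closure]
  exact interior_mono (hT.tri_subset hK)

theorem IsPolygonalDomain.restrict_closure (hΩ : IsPolygonalDomain Ω) :
    (volume : Measure Plane).restrict (closure Ω) = volume.restrict Ω := by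
  refine Measure.restrict_congr_set (ae_eq_set.mpr ⟨?_, ?_⟩)
  · have h : volume (frontier Ω) = 0 := by
      obtain ⟨S, hS⟩ := hΩ.frontier_eq
      rw [hS]
      exact (measure_biUnion_null_iff S.countable_toSet).mpr fun e _ => volume_segment _ _
    rwa [frontier, hΩ.isOpen.interior_eq] at h
  · rw [Set.sdiff_eq_empty.mpr subset_closure, measure_empty]

theorem IsTriangulation.restrict_tri_le (hΩ : IsPolygonalDomain Ω) (hT : IsTriangulation Ω T)
    {K : Finset Plane} (hK : K ∈ T) :
    (volume : Measure Plane).restrict (tri K) ≤ volume.restrict Ω := by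
  rw [← hΩ.restrict_closure]
  exact Measure.restrict_mono (hT.tri_subset hK) le_rfl

theorem IsTriangulation.ae_iff (hΩ : IsPolygonalDomain Ω) (hT : IsTriangulation Ω T)
    {p : Plane → Prop} : (∀ᵐ x ∂(volume.restrict Ω), p x) ↔
      ∀ K ∈ T, ∀ᵐ x ∂(volume.restrict (tri K)), p x := by
  rw [← hΩ.restrict_closure, ← hT.cover, ae_restrict_biUnion_finset_iff]

theorem IsTriangulation.setIntegral_indicator (hΩ : IsPolygonalDomain Ω)
    (hT : IsTriangulation Ω T) {K : Finset Plane} (hK : K ∈ T) (g : Plane → ℝ) :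
    ∫ x in Ω, (tri K).indicator g x = ∫ x in tri K, g x := by
  rw [← hΩ.restrict_closure, integral_indicator (measurableSet_tri K),
    Measure.restrict_restrict (measurableSet_tri K), Set.inter_eq_left.mpr (hT.tri_subset hK)]

theorem IsTriangulation.memLp_tri (hΩ : IsPolygonalDomain Ω) (hT : IsTriangulation Ω T)
    {K : Finset Plane} (hK : K ∈ T) {g : Plane → ℝ} (hg : MemL2 Ω g) :
    MemLp g 2 (volume.restrict (tri K)) :=
  hg.mono_measure (hT.restrict_tri_le hΩ hK)

/-- The inner product of `L²(Ω)` with a function that lives on one triangle. -/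
theorem IsTriangulation.ip_restr (hΩ : IsPolygonalDomain Ω) (hT : IsTriangulation Ω T)
    {K : Finset Plane} (hK : K ∈ T) (g : Plane → ℝ) {r : Plane → ℝ} {P : MvPolynomial (Fin 2) ℝ}
    (hr : r =ᵐ[volume.restrict Ω] restr K P) :
    ip Ω g r = ∫ x in tri K, g x * evalAt P x := by
  rw [← hT.setIntegral_indicator hΩ hK, ip]
  refine integral_congr_ae ?_
  filter_upwards [hr] with x hx
  rw [hx, restr_apply]
  by_cases hxK : x ∈ tri K <;> simp [hxK]

/-- A sum of functions that live on one triangle each. -/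
theorem IsTriangulation.sum_ae_eq (hT : IsTriangulation Ω T) {r : Finset Plane → Plane → ℝ}
    (hr : ∀ K ∈ T, ∀ x ∉ tri K, r K x = 0) {K : Finset Plane} (hK : K ∈ T) :
    (∑ K' ∈ T, r K') =ᵐ[volume.restrict (tri K)] r K := by
  have h : ∀ K' ∈ T, ∀ᵐ x ∂(volume.restrict (tri K)), K' ≠ K → x ∉ tri K' := fun K' hK' => by
    rw [ae_restrict_iff' (measurableSet_tri K)]
    by_cases hne : K' = K
    · exact Eventually.of_forall fun _ _ h => absurd hne h
    · have h0 := measure_eq_zero_iff_ae_notMem.mp (hT.volume_inter hK hK' (Ne.symm hne))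
      filter_upwards [h0] with x hx hxK _ hxK'
      exact hx ⟨hxK, hxK'⟩
  filter_upwards [(ae_ball_iff T.countable_toSet).mpr h] with x hx
  rw [Finset.sum_apply]
  exact Finset.sum_eq_single_of_mem K hK fun K' hK' hne => hr K' hK' x (hx K' hK' hne)

end Triangulation

/-! ### Local pressures and non-sting components -/

section Local

variable {Ω : Set Plane} {T : Finset (Finset Plane)} {K : Finset Plane}
  {M : Matrix (Fin 2) (Fin 2) ℝ} {t : Plane}

theorem mem_bubbleSpace {v : Fin 2 → Plane → ℝ} :
    v ∈ bubbleSpace K ↔ ∃ P ∈ bubblePoly (tri K), v = fun i => restr K (P i) := by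
  have hmem : ∀ x ∈ frontier (tri K), x ∈ tri K := fun x hx =>
    (isCompact_tri K).isClosed.frontier_subset hx
  constructor
  · intro hv
    choose P hdeg hP using fun i => (hv i).1
    refine ⟨P, fun i => ⟨hdeg i, fun x hx => ?_⟩, funext hP⟩
    have := (hv i).2 x hx
    rwa [hP, Set.indicator_of_mem (hmem x hx)] at this
  · rintro ⟨P, hP, rfl⟩ i
    refine ⟨⟨P i, (hP i).1, rfl⟩, fun x hx => ?_⟩
    change (tri K).indicator (evalAt (P i)) x = 0
    rw [Set.indicator_of_mem (hmem x hx), (hP i).2 x hx]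

theorem weakPartial_restr_ae_eq (hΩ : IsOpen Ω) {P : Fin 2 → MvPolynomial (Fin 2) ℝ}
    (hP : P ∈ bubblePoly (tri K)) (i j : Fin 2) :
    weakPartial Ω j (restr K (P i)) =ᵐ[volume.restrict Ω] restr K (pderiv j (P i)) :=
  weakPartial_indicator_ae_eq hΩ (isCompact_tri K) (hP i).2 j

theorem divergence_restr_ae_eq (hΩ : IsOpen Ω) {P : Fin 2 → MvPolynomial (Fin 2) ℝ}
    (hP : P ∈ bubblePoly (tri K)) :
    divergence Ω (fun i => restr K (P i)) =ᵐ[volume.restrict Ω] restr K (divPoly P) := by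
  filter_upwards [weakPartial_restr_ae_eq hΩ hP 0 0, weakPartial_restr_ae_eq hΩ hP 1 1]
    with x h0 h1
  rw [divergence, Fin.sum_univ_two, h0, h1, divPoly_apply, Fin.sum_univ_two, map_add, Pi.add_apply]

theorem restr_injective (hpar : IsParam K M t) {P Q : MvPolynomial (Fin 2) ℝ}
    (h : restr K P =ᵐ[volume.restrict (tri K)] restr K Q) : P = Q :=
  eq_of_evalAt_ae_eq hpar.interior_nonempty
    ((restr_ae_eq K P).symm.trans (h.trans (restr_ae_eq K Q)))

theorem mem_nonStingSpace (hΩ : IsPolygonalDomain Ω) (hT : IsTriangulation Ω T) (hK : K ∈ T)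
    (hpar : IsParam K M t) {q : Plane → ℝ} :
    q ∈ nonStingSpace Ω K ↔ ∃ P ∈ bubblePoly (tri K), q = restr K (divPoly P) := by
  constructor
  · rintro ⟨⟨Q, -, rfl⟩, v, hv, hq⟩
    obtain ⟨P, hP, rfl⟩ := mem_bubbleSpace.mp hv
    refine ⟨P, hP, ?_⟩
    have h := hq.trans (divergence_restr_ae_eq hΩ.isOpen hP)
    rw [restr_injective hpar (ae_mono (hT.restrict_tri_le hΩ hK) h), restr_apply]
  · rintro ⟨P, hP, rfl⟩
    exact ⟨⟨_, totalDegree_divPoly_le hP, rfl⟩, _, mem_bubbleSpace.mpr ⟨P, hP, rfl⟩,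
      (divergence_restr_ae_eq hΩ.isOpen hP).symm⟩

theorem ipVec_restr (hΩ : IsPolygonalDomain Ω) (hT : IsTriangulation Ω T) (hK : K ∈ T)
    (f : Fin 2 → Plane → ℝ) (P : Fin 2 → MvPolynomial (Fin 2) ℝ) :
    ipVec Ω f (fun i => restr K (P i)) = ∑ i, ∫ x in tri K, f i x * evalAt (P i) x :=
  Finset.sum_congr rfl fun _ _ => hT.ip_restr hΩ hK _ (ae_eq_refl _)

theorem ipGrad_restr (hΩ : IsPolygonalDomain Ω) (hT : IsTriangulation Ω T) (hK : K ∈ T)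
    (u : Fin 2 → Plane → ℝ) {P : Fin 2 → MvPolynomial (Fin 2) ℝ} (hP : P ∈ bubblePoly (tri K)) :
    ipGrad Ω u (fun i => restr K (P i)) =
      ∑ i, ∑ j, ∫ x in tri K, weakPartial Ω j (u i) x * evalAt (pderiv j (P i)) x :=
  Finset.sum_congr rfl fun i _ => Finset.sum_congr rfl fun j _ =>
    hT.ip_restr hΩ hK _ (weakPartial_restr_ae_eq hΩ.isOpen hP i j)

theorem ip_divergence_restr (hΩ : IsPolygonalDomain Ω) (hT : IsTriangulation Ω T) (hK : K ∈ T)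
    (g : Plane → ℝ) {P : Fin 2 → MvPolynomial (Fin 2) ℝ} (hP : P ∈ bubblePoly (tri K)) :
    ip Ω g (divergence Ω fun i => restr K (P i)) = ∫ x in tri K, g x * evalAt (divPoly P) x :=
  hT.ip_restr hΩ hK _ (divergence_restr_ae_eq hΩ.isOpen hP)

/-- The local pressure problem in terms of polynomials. -/
theorem isLocalPressure_iff (hΩ : IsPolygonalDomain Ω) (hT : IsTriangulation Ω T) (hK : K ∈ T)
    (hpar : IsParam K M t) {f uh : Fin 2 → Plane → ℝ} {q : Plane → ℝ} :
    IsLocalPressure Ω f uh K q ↔ ∃ R ∈ bubblePoly (tri K), q = restr K (divPoly R) ∧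
      ∀ P ∈ bubblePoly (tri K), l2Form (isCompact_tri K) (divPoly R) (divPoly P) =
        (∑ i, ∫ x in tri K, f i x * evalAt (P i) x) -
        ∑ i, ∑ j, ∫ x in tri K, weakPartial Ω j (uh i) x * evalAt (pderiv j (P i)) x := by
  have hip : ∀ R : MvPolynomial (Fin 2) ℝ, ∀ P ∈ bubblePoly (tri K),
      ip Ω (restr K R) (divergence Ω fun i => restr K (P i)) =
        l2Form (isCompact_tri K) R (divPoly P) := fun R P hP => by
    rw [ip_divergence_restr hΩ hT hK _ hP]
    refine integral_congr_ae ?_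
    filter_upwards [restr_ae_eq K R] with x hx
    rw [hx]
  constructor
  · rintro ⟨hq, h⟩
    obtain ⟨R, hR, rfl⟩ := (mem_nonStingSpace hΩ hT hK hpar).mp hq
    refine ⟨R, hR, rfl, fun P hP => ?_⟩
    rw [← hip _ P hP, h _ (mem_bubbleSpace.mpr ⟨P, hP, rfl⟩), ipVec_restr hΩ hT hK,
      ipGrad_restr hΩ hT hK _ hP]
  · rintro ⟨R, hR, rfl, h⟩
    refine ⟨(mem_nonStingSpace hΩ hT hK hpar).mpr ⟨R, hR, rfl⟩, fun v hv => ?_⟩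
    obtain ⟨P, hP, rfl⟩ := mem_bubbleSpace.mp hv
    rw [hip _ P hP, h P hP, ipVec_restr hΩ hT hK, ipGrad_restr hΩ hT hK _ hP]

/-- The local pressure exists since the divergence is injective on the bubble fields, so that the
`L²` inner product of divergences is definite on them. -/
theorem existsUnique_isLocalPressure (hΩ : IsPolygonalDomain Ω) (hT : IsTriangulation Ω T)
    (hK : K ∈ T) (hpar : IsParam K M t) {f : Fin 2 → Plane → ℝ} (hf : ∀ i, MemL2 Ω (f i))
    (uh : Fin 2 → Plane → ℝ) : ∃! q, IsLocalPressure Ω f uh K q := by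
  have hKc := isCompact_tri K
  let ι := (bubblePoly (tri K)).subtype
  let l : (Fin 2 → MvPolynomial (Fin 2) ℝ) →ₗ[ℝ] ℝ :=
    (∑ i, moment hKc (hT.memLp_tri hΩ hK (hf i)) ∘ₗ LinearMap.proj i) -
      ∑ i, ∑ j, moment hKc (hT.memLp_tri hΩ hK (memL2_weakPartial Ω j (uh i))) ∘ₗ
        (pderiv j).toLinearMap ∘ₗ LinearMap.proj i
  obtain ⟨⟨R, hR⟩, hRl⟩ := exists_forall_apply_eq
    ((l2Form hKc).compl₁₂ (divPoly ∘ₗ ι) (divPoly ∘ₗ ι))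
    (fun P hP => Subtype.ext (hpar.eq_zero_of_divPoly_eq_zero P.2
      (eq_zero_of_l2Form_self hKc hpar.interior_nonempty hP))) (l ∘ₗ ι)
  refine ⟨restr K (divPoly R), (isLocalPressure_iff hΩ hT hK hpar).mpr
    ⟨R, hR, rfl, fun P hP => ?_⟩, fun q hq => ?_⟩
  · have h : l2Form hKc (divPoly R) (divPoly P) = l P := hRl ⟨P, hP⟩
    rw [h]
    simp only [l, LinearMap.sub_apply, LinearMap.sum_apply, LinearMap.comp_apply, moment_apply,
      LinearMap.proj_apply, Derivation.coeFn_coe]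
  · obtain ⟨R', hR', rfl, h'⟩ := (isLocalPressure_iff hΩ hT hK hpar).mp hq
    have h : ∀ P ∈ bubblePoly (tri K), l2Form hKc (divPoly R) (divPoly P) = l P :=
      fun P hP => hRl ⟨P, hP⟩
    have h0 : divPoly (R' - R) = 0 := by
      refine eq_zero_of_l2Form_self hKc hpar.interior_nonempty ?_
      have hsub := Submodule.sub_mem _ hR' hR
      conv_lhs => arg 1; rw [map_sub]
      rw [map_sub, LinearMap.sub_apply, h' _ hsub, h _ hsub]
      simp only [l, LinearMap.sub_apply, LinearMap.sum_apply, LinearMap.comp_apply, moment_apply,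
        LinearMap.proj_apply, Derivation.coeFn_coe, sub_self]
    rw [map_sub] at h0
    rw [sub_eq_zero.mp h0]

/-- The non-sting component in terms of polynomials: the decomposition is local. -/
theorem isNonStingComponent_iff (hΩ : IsPolygonalDomain Ω) (hT : IsTriangulation Ω T)
    (hpar : ∀ K ∈ T, ∃ M t, IsParam K M t) {q qN : Plane → ℝ} :
    IsNonStingComponent Ω T q qN ↔ ∃ P : Finset Plane → Fin 2 → MvPolynomial (Fin 2) ℝ,
      (∀ K ∈ T, P K ∈ bubblePoly (tri K)) ∧ qN = ∑ K ∈ T, restr K (divPoly (P K)) ∧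
      ∀ K ∈ T, ∃ z ∈ Submodule.span ℝ (stingPoly K), ∃ c : ℝ,
        q =ᵐ[volume.restrict (tri K)] evalAt (divPoly (P K) + z + C c) := by
  have hsum : ∀ Q : Finset Plane → MvPolynomial (Fin 2) ℝ, ∀ K ∈ T,
      (∑ K' ∈ T, restr K' (Q K')) =ᵐ[volume.restrict (tri K)] evalAt (Q K) := fun Q K hK =>
    (hT.sum_ae_eq (fun _ _ _ hx => Set.indicator_of_notMem hx _) hK).trans (restr_ae_eq K (Q K))
  constructor
  · rintro ⟨⟨r, hr, rfl⟩, _, ⟨rS, hrS, rfl⟩, _, ⟨rC, hrC, rfl⟩, h⟩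
    have hN : ∀ K, ∃ P, K ∈ T → P ∈ bubblePoly (tri K) ∧ r K = restr K (divPoly P) := fun K => by
      by_cases hK : K ∈ T
      · obtain ⟨M, t, hp⟩ := hpar K hK
        obtain ⟨P, hP⟩ := (mem_nonStingSpace hΩ hT hK hp).mp (hr K hK)
        exact ⟨P, fun _ => hP⟩
      · exact ⟨0, fun h => absurd h hK⟩
    have hS : ∀ K, ∃ z, K ∈ T → z ∈ Submodule.span ℝ (stingPoly K) ∧ rS K = restr K z :=
      fun K => by
      by_cases hK : K ∈ T
      · have := hrS K hK
        rw [stingSpace_eq] at this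
        obtain ⟨z, hz, hzr⟩ := this
        exact ⟨z, fun _ => ⟨hz, hzr.symm⟩⟩
      · exact ⟨0, fun h => absurd h hK⟩
    have hC : ∀ K, ∃ c, K ∈ T → rC K = restr K (C c) := fun K => by
      by_cases hK : K ∈ T
      · obtain ⟨c, hc⟩ := mem_constSpace.mp (hrC K hK)
        exact ⟨c, fun _ => hc⟩
      · exact ⟨0, fun h => absurd h hK⟩
    choose P hP using hN
    choose z hz using hS
    choose c hc using hC
    refine ⟨P, fun K hK => (hP K hK).1, Finset.sum_congr rfl fun K hK => (hP K hK).2,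
      fun K hK => ⟨z K, (hz K hK).1, c K, ?_⟩⟩
    rw [Finset.sum_congr rfl fun K hK => (hP K hK).2,
      Finset.sum_congr rfl fun K hK => (hz K hK).2, Finset.sum_congr rfl fun K hK => hc K hK] at h
    filter_upwards [(hT.ae_iff hΩ).mp h K hK, hsum (fun K => divPoly (P K)) K hK, hsum z K hK,
      hsum (fun K => C (c K)) K hK] with x h0 h1 h2 h3
    rw [h0, Pi.add_apply, Pi.add_apply, h1, h2, h3, evalAt_add, evalAt_add]
  · rintro ⟨P, hP, rfl, h⟩
    have h' : ∀ K, ∃ z : MvPolynomial (Fin 2) ℝ, ∃ c : ℝ, K ∈ T →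
        z ∈ Submodule.span ℝ (stingPoly K) ∧
        q =ᵐ[volume.restrict (tri K)] evalAt (divPoly (P K) + z + C c) := fun K => by
      by_cases hK : K ∈ T
      · obtain ⟨z, hz, c, hc⟩ := h K hK
        exact ⟨z, c, fun _ => ⟨hz, hc⟩⟩
      · exact ⟨0, 0, fun h => absurd h hK⟩
    choose z c hzc using h'
    refine ⟨⟨_, fun K hK => ?_, rfl⟩, _, ⟨fun K => restr K (z K), fun K hK => ?_, rfl⟩,
      _, ⟨fun K => restr K (C (c K)), fun K _ => mem_constSpace.mpr ⟨_, rfl⟩, rfl⟩,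
      (hT.ae_iff hΩ).mpr fun K hK => ?_⟩
    · obtain ⟨M, t, hp⟩ := hpar K hK
      exact (mem_nonStingSpace hΩ hT hK hp).mpr ⟨P K, hP K hK, rfl⟩
    · rw [stingSpace_eq]
      exact ⟨z K, (hzc K hK).1, rfl⟩
    · filter_upwards [(hzc K hK).2, hsum (fun K => divPoly (P K)) K hK, hsum z K hK,
        hsum (fun K => C (c K)) K hK] with x h0 h1 h2 h3
      rw [h0, Pi.add_apply, Pi.add_apply, h1, h2, h3, evalAt_add, evalAt_add]

theorem existsUnique_isNonStingComponent (hΩ : IsPolygonalDomain Ω) (hT : IsTriangulation Ω T)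
    (hpar : ∀ K ∈ T, ∃ M t, IsParam K M t) {q : Plane → ℝ} (hq : IsPiecewisePoly T 3 q) :
    ∃! qN, IsNonStingComponent Ω T q qN := by
  have hex : ∀ K, ∃ P : Fin 2 → MvPolynomial (Fin 2) ℝ, K ∈ T → P ∈ bubblePoly (tri K) ∧
      ∃ z ∈ Submodule.span ℝ (stingPoly K), ∃ c : ℝ,
        q =ᵐ[volume.restrict (tri K)] evalAt (divPoly P + z + C c) := fun K => by
    by_cases hK : K ∈ T
    · obtain ⟨M, t, hp⟩ := hpar K hK
      obtain ⟨Q, hdeg, hQ⟩ := hq K hK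
      obtain ⟨P, hP, z, hz, c, rfl⟩ := hp.exists_decomposition hdeg
      exact ⟨P, fun _ => ⟨hP, z, hz, c, hQ⟩⟩
    · exact ⟨0, fun h => absurd h hK⟩
  choose P hP using hex
  refine ⟨_, (isNonStingComponent_iff hΩ hT hpar).mpr ⟨P, fun K hK => (hP K hK).1, rfl,
    fun K hK => (hP K hK).2⟩, fun qN hqN => ?_⟩
  obtain ⟨P', hP', rfl, h'⟩ := (isNonStingComponent_iff hΩ hT hpar).mp hqN
  refine Finset.sum_congr rfl fun K hK => ?_
  obtain ⟨M, t, hp⟩ := hpar K hK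
  obtain ⟨hPK, z, hz, c, h1⟩ := hP K hK
  obtain ⟨z', hz', c', h2⟩ := h' K hK
  have heq := eq_of_evalAt_ae_eq hp.interior_nonempty (h2.symm.trans h1)
  have hsub := Submodule.sub_mem _ (hP' K hK) hPK
  -- the difference is orthogonal to itself
  have h0 : divPoly (P' K - P K) = 0 := by
    refine eq_zero_of_l2Form_self (isCompact_tri K) hp.interior_nonempty ?_
    have hd : divPoly (P' K - P K) = (z - z') + C (c - c') := by
      rw [map_sub, C_sub]
      linear_combination heq
    conv_lhs => arg 1; rw [hd]
    rw [map_add, LinearMap.add_apply, hp.l2Form_sting_divPoly (Submodule.sub_mem _ hz hz') hsub,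
      l2Form_const_divPoly _ hsub, add_zero]
  rw [map_sub] at h0
  rw [sub_eq_zero.mp h0]

end Local

/-! ### The error estimate -/

theorem integral_mul_le_sqrt_mul_sqrt {μ : Measure Plane} {f g : Plane → ℝ} (hf : MemLp f 2 μ)
    (hg : MemLp g 2 μ) :
    ∫ x, f x * g x ∂μ ≤ √(∫ x, f x ^ 2 ∂μ) * √(∫ x, g x ^ 2 ∂μ) := by
  have h := integral_mul_norm_le_Lp_mul_Lq (μ := μ) (f := f) (g := g) (p := 2) (q := 2)
    (Real.HolderConjugate.two_two) (by simpa using hf) (by simpa using hg)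
  simp only [Real.rpow_two, Real.norm_eq_abs, sq_abs, ← Real.sqrt_eq_rpow] at h
  refine le_trans
    (integral_mono (hf.integrable_mul hg) (hf.abs.integrable_mul hg.abs) fun x => ?_) h
  exact (le_abs_self _).trans (abs_mul _ _).le

theorem velocitySpace_memH1 {Ω : Set Plane} {T : Finset (Finset Plane)}
    {w : Fin 2 → Plane → ℝ} (hw : w ∈ velocitySpace Ω T) (i : Fin 2) : MemH1 Ω (w i) := by
  obtain ⟨φ, -, hφ, h0, h1⟩ := hw
  fin_cases i
  · exact (hφ.1.2 1).congr_ae h0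
  · exact (hφ.1.2 0).neg.congr_ae h1

section Estimate

variable {Ω : Set Plane} {T : Finset (Finset Plane)} {K : Finset Plane}
  {M : Matrix (Fin 2) (Fin 2) ℝ} {t : Plane}

/-- The error equation: the Stokes equation is tested with the bubble field `D` whose divergence is
the error on `K`. -/
theorem integral_divPoly_sq_eq (hΩ : IsPolygonalDomain Ω) (hT : IsTriangulation Ω T) (hK : K ∈ T)
    (hpar : IsParam K M t) {f u uh : Fin 2 → Plane → ℝ} {p pih : Plane → ℝ}
    (hst : IsStokesSolution Ω f u p) (huh : ∀ i, MemH1 Ω (uh i))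
    {P R : Fin 2 → MvPolynomial (Fin 2) ℝ} (hP : P ∈ bubblePoly (tri K))
    (hR : R ∈ bubblePoly (tri K)) {z : MvPolynomial (Fin 2) ℝ}
    (hz : z ∈ Submodule.span ℝ (stingPoly K)) {c : ℝ}
    (hpih : pih =ᵐ[volume.restrict (tri K)] evalAt (divPoly P + z + C c))
    (hRl : ∀ D ∈ bubblePoly (tri K), l2Form (isCompact_tri K) (divPoly R) (divPoly D) =
        (∑ i, ∫ x in tri K, f i x * evalAt (D i) x) -
        ∑ i, ∑ j, ∫ x in tri K, weakPartial Ω j (uh i) x * evalAt (pderiv j (D i)) x) :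
    ∫ x in tri K, evalAt (divPoly (P - R)) x ^ 2 =
      -(∫ x in tri K, (p - pih) x * evalAt (divPoly (P - R)) x) -
      ∑ i, ∑ j, ∫ x in tri K, weakPartial Ω j ((u - uh) i) x *
        evalAt (pderiv j ((P - R) i)) x := by
  have hKc := isCompact_tri K
  have hD : P - R ∈ bubblePoly (tri K) := Submodule.sub_mem _ hP hR
  set D := P - R with hDdef
  have hp : MemLp p 2 (volume.restrict (tri K)) := hT.memLp_tri hΩ hK hst.2.1.1
  have hpih' : MemLp pih 2 (volume.restrict (tri K)) := (memLp_evalAt hKc _).ae_eq hpih.symm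
  have h1 : ∫ x in tri K, evalAt (divPoly D) x ^ 2 =
      l2Form hKc (divPoly P) (divPoly D) - l2Form hKc (divPoly R) (divPoly D) := by
    rw [← LinearMap.sub_apply, ← map_sub, ← map_sub, ← hDdef]
    simp only [l2Form_apply, sq]
  have h2 : ∫ x in tri K, pih x * evalAt (divPoly D) x = l2Form hKc (divPoly P) (divPoly D) := by
    have : ∫ x in tri K, pih x * evalAt (divPoly D) x =
        l2Form hKc (divPoly P + z + C c) (divPoly D) := by
      refine integral_congr_ae ?_
      filter_upwards [hpih] with x hx
      rw [hx]
    rw [this, map_add, map_add, LinearMap.add_apply, LinearMap.add_apply,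
      hpar.l2Form_sting_divPoly hz hD, l2Form_const_divPoly c hD, add_zero, add_zero]
  have h3 : ∫ x in tri K, (p - pih) x * evalAt (divPoly D) x =
      (∫ x in tri K, p x * evalAt (divPoly D) x) -
        ∫ x in tri K, pih x * evalAt (divPoly D) x := by
    simp only [Pi.sub_apply, sub_mul]
    exact integral_sub (integrable_mul_evalAt hKc hp _) (integrable_mul_evalAt hKc hpih' _)
  have h4 : ∀ i j, ∫ x in tri K, weakPartial Ω j ((u - uh) i) x * evalAt (pderiv j (D i)) x =
      (∫ x in tri K, weakPartial Ω j (u i) x * evalAt (pderiv j (D i)) x) -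
        ∫ x in tri K, weakPartial Ω j (uh i) x * evalAt (pderiv j (D i)) x := fun i j => by
    rw [← integral_sub
      (integrable_mul_evalAt hKc (hT.memLp_tri hΩ hK (memL2_weakPartial Ω j (u i))) _)
      (integrable_mul_evalAt hKc (hT.memLp_tri hΩ hK (memL2_weakPartial Ω j (uh i))) _)]
    refine integral_congr_ae ?_
    filter_upwards [ae_mono (hT.restrict_tri_le hΩ hK)
      (weakPartial_sub_ae_eq hΩ.isOpen (hst.1 i).1 (huh i) j)] with x hx
    rw [Pi.sub_apply, hx, Pi.sub_apply, sub_mul]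
  have h5 := hst.2.2 (fun i => restr K (D i)) 0
    (fun i => memH10_indicator hΩ.isOpen hKc (hT.interior_tri_subset hΩ hK) (hD i).2)
    ⟨MemLp.zero', by simp⟩
  rw [ipGrad_restr hΩ hT hK _ hD, ip_divergence_restr hΩ hT hK _ hD, ipVec_restr hΩ hT hK] at h5
  have h6 : ip Ω 0 (divergence Ω u) = 0 := by simp [ip]
  simp only [h4, Finset.sum_sub_distrib]
  rw [h1, h3, h2, hRl D hD]
  linarith

/-- The estimate on one triangle, with the constant in terms of the bound of the gradient of bubble
fields by their divergence. -/
theorem normL2_le (hΩ : IsPolygonalDomain Ω) (hT : IsTriangulation Ω T) (hK : K ∈ T)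
    (hpar : IsParam K M t) {c' : ℝ} (hc' : 0 ≤ c')
    (hgrad : ∀ D ∈ bubblePoly (tri K), ∫ x in tri K, ∑ i, ∑ j, evalAt (pderiv j (D i)) x ^ 2 ≤
      c' * ∫ x in tri K, evalAt (divPoly D) x ^ 2)
    {f u uh : Fin 2 → Plane → ℝ} {p pih : Plane → ℝ}
    (hst : IsStokesSolution Ω f u p) (huh : ∀ i, MemH1 Ω (uh i))
    {P R : Fin 2 → MvPolynomial (Fin 2) ℝ} (hP : P ∈ bubblePoly (tri K))
    (hR : R ∈ bubblePoly (tri K)) {z : MvPolynomial (Fin 2) ℝ}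
    (hz : z ∈ Submodule.span ℝ (stingPoly K)) {c : ℝ}
    (hpih : pih =ᵐ[volume.restrict (tri K)] evalAt (divPoly P + z + C c))
    (hRl : ∀ D ∈ bubblePoly (tri K), l2Form (isCompact_tri K) (divPoly R) (divPoly D) =
        (∑ i, ∫ x in tri K, f i x * evalAt (D i) x) -
        ∑ i, ∑ j, ∫ x in tri K, weakPartial Ω j (uh i) x * evalAt (pderiv j (D i)) x) :
    normL2 (tri K) (evalAt (divPoly (P - R))) ≤
      (√c' + 1) * (seminormH1 Ω (tri K) (u - uh) + normL2 (tri K) (p - pih)) := by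
  have hKc := isCompact_tri K
  have hD : P - R ∈ bubblePoly (tri K) := Submodule.sub_mem _ hP hR
  have heq := integral_divPoly_sq_eq hΩ hT hK hpar hst huh hP hR hz hpih hRl
  have hp : MemLp p 2 (volume.restrict (tri K)) := hT.memLp_tri hΩ hK hst.2.1.1
  have hpih' : MemLp pih 2 (volume.restrict (tri K)) := (memLp_evalAt hKc _).ae_eq hpih.symm
  set D := P - R
  have h1 : -(∫ x in tri K, (p - pih) x * evalAt (divPoly D) x) ≤
      normL2 (tri K) (p - pih) * normL2 (tri K) (evalAt (divPoly D)) := by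
    have := integral_mul_le_sqrt_mul_sqrt (hp.sub hpih').neg (memLp_evalAt hKc (divPoly D))
    simpa only [normL2, Pi.neg_apply, neg_mul, integral_neg, neg_sq] using this
  have h2 : -(∑ i, ∑ j, ∫ x in tri K, weakPartial Ω j ((u - uh) i) x *
      evalAt (pderiv j (D i)) x) ≤ seminormH1 Ω (tri K) (u - uh) *
        √(∫ x in tri K, ∑ i, ∑ j, evalAt (pderiv j (D i)) x ^ 2) := by
    have hterm : ∀ i j, -(∫ x in tri K, weakPartial Ω j ((u - uh) i) x *
        evalAt (pderiv j (D i)) x) ≤ √(∫ x in tri K, weakPartial Ω j ((u - uh) i) x ^ 2) *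
          √(∫ x in tri K, evalAt (pderiv j (D i)) x ^ 2) := fun i j => by
      have := integral_mul_le_sqrt_mul_sqrt
        (hT.memLp_tri hΩ hK (memL2_weakPartial Ω j ((u - uh) i))).neg
        (memLp_evalAt hKc (pderiv j (D i)))
      simpa only [Pi.neg_apply, neg_mul, integral_neg, neg_sq] using this
    rw [integral_finsetSum _ fun i _ => integrable_finsetSum _ fun j _ =>
      integrable_evalAt_sq hKc _]
    simp_rw [integral_finsetSum _ fun j _ => integrable_evalAt_sq hKc _]
    have hCS := Real.sum_sqrt_mul_sqrt_le (Finset.univ : Finset (Fin 2 × Fin 2))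
      (f := fun ij => ∫ x in tri K, weakPartial Ω ij.2 ((u - uh) ij.1) x ^ 2)
      (g := fun ij => ∫ x in tri K, evalAt (pderiv ij.2 (D ij.1)) x ^ 2)
      (fun _ => integral_nonneg fun _ => sq_nonneg _)
      (fun _ => integral_nonneg fun _ => sq_nonneg _)
    simp only [Fintype.sum_prod_type] at hCS
    refine le_trans ?_ hCS
    simp only [← Finset.sum_neg_distrib]
    exact Finset.sum_le_sum fun i _ => Finset.sum_le_sum fun j _ => hterm i j
  have h3 : √(∫ x in tri K, ∑ i, ∑ j, evalAt (pderiv j (D i)) x ^ 2) ≤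
      √c' * normL2 (tri K) (evalAt (divPoly D)) := by
    rw [normL2, ← Real.sqrt_mul hc']
    exact Real.sqrt_le_sqrt (hgrad D hD)
  have h4 : normL2 (tri K) (evalAt (divPoly D)) ^ 2 =
      ∫ x in tri K, evalAt (divPoly D) x ^ 2 :=
    Real.sq_sqrt (integral_nonneg fun _ => sq_nonneg _)
  have hN : 0 ≤ normL2 (tri K) (evalAt (divPoly D)) := Real.sqrt_nonneg _
  have hE : 0 ≤ normL2 (tri K) (p - pih) := Real.sqrt_nonneg _
  have hG : 0 ≤ seminormH1 Ω (tri K) (u - uh) := Real.sqrt_nonneg _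
  have hs : 0 ≤ √c' := Real.sqrt_nonneg _
  have h5 := mul_le_mul_of_nonneg_left h3 hG
  set N := normL2 (tri K) (evalAt (divPoly D))
  set E := normL2 (tri K) (p - pih)
  set G := seminormH1 Ω (tri K) (u - uh)
  have h6 : N * N ≤ (E + √c' * G) * N := by nlinarith
  have h7 : N ≤ E + √c' * G := by
    rcases hN.eq_or_lt with h0 | h0
    · rw [← h0]; positivity
    · exact le_of_mul_le_mul_right h6 h0
  nlinarith [mul_nonneg hs hE]

end Estimate

end StokesFE

end

theorem lemma4p1 (ϑ : ℝ) (hϑ : 0 < ϑ) :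
    ∃ C : ℝ, 0 < C ∧
      ∀ (Ω : Set StokesFE.Plane) (T : Finset (Finset StokesFE.Plane))
        (f u uh : Fin 2 → StokesFE.Plane → ℝ) (p : StokesFE.Plane → ℝ)
        (gradp : StokesFE.Plane → StokesFE.Plane) (pih : StokesFE.Plane → ℝ),
        StokesFE.IsPolygonalDomain Ω →
        StokesFE.IsTriangulation Ω T →
        StokesFE.MinAngle ϑ T →
        (∀ i, StokesFE.MemL2 Ω (f i)) →
        StokesFE.IsStokesSolution Ω f u p →
        StokesFE.IsDiscreteVelocity Ω T f uh →
        StokesFE.IsC1UpToBoundary Ω p gradp →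
        StokesFE.IsHermiteInterpolation T p gradp pih →
        (∀ K ∈ T, ∃! q, StokesFE.IsLocalPressure Ω f uh K q) ∧
        (∃! piN, StokesFE.IsNonStingComponent Ω T pih piN) ∧
        ∀ (pK : Finset StokesFE.Plane → StokesFE.Plane → ℝ) (piN : StokesFE.Plane → ℝ),
          (∀ K ∈ T, StokesFE.IsLocalPressure Ω f uh K (pK K)) →
          StokesFE.IsNonStingComponent Ω T pih piN →
          ∀ K ∈ T,
            StokesFE.normL2 (StokesFE.tri K) (piN - ∑ K' ∈ T, pK K') ≤
              C * (StokesFE.seminormH1 Ω (StokesFE.tri K) (u - uh) +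
                StokesFE.normL2 (StokesFE.tri K) (p - pih)) := by
  obtain ⟨Cref, hCref, hCle⟩ := StokesFE.exists_refTri_gradient_le
  refine ⟨√(Cref * (4 / Real.sin ϑ ^ 4)) + 1, by positivity, ?_⟩
  intro Ω T f u uh p gradp pih hΩ hT hangle hf hst huh _ hpih
  have hpar : ∀ K ∈ T, ∃ M t, StokesFE.IsParam K M t := fun K hK => by
    obtain ⟨M, t, h, -⟩ := StokesFE.exists_isParam hϑ (hT.card_eq K hK) (hangle K hK)
    exact ⟨M, t, h⟩
  refine ⟨fun K hK => ?_, ?_, fun pK piN hpK hpiN K hK => ?_⟩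
  · obtain ⟨M, t, h⟩ := hpar K hK
    exact StokesFE.existsUnique_isLocalPressure hΩ hT hK h hf uh
  · refine StokesFE.existsUnique_isNonStingComponent hΩ hT hpar fun K hK => ?_
    obtain ⟨P, hdeg, hP, -⟩ := hpih K hK
    exact ⟨P, hdeg, hP⟩
  · obtain ⟨M, t, h, hκ⟩ := StokesFE.exists_isParam hϑ (hT.card_eq K hK) (hangle K hK)
    obtain ⟨P, hP, rfl, hz⟩ := (StokesFE.isNonStingComponent_iff hΩ hT hpar).mp hpiN
    obtain ⟨z, hz, c, hzc⟩ := hz K hK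
    obtain ⟨R, hR, hRK, hRl⟩ := (StokesFE.isLocalPressure_iff hΩ hT hK h).mp (hpK K hK)
    have hzero : ∀ K' ∈ T, ∀ x ∉ StokesFE.tri K', pK K' x = 0 := fun K' hK' x hx => by
      obtain ⟨M', t', h'⟩ := hpar K' hK'
      obtain ⟨R', -, hR', -⟩ := (StokesFE.isLocalPressure_iff hΩ hT hK' h').mp (hpK K' hK')
      rw [hR']
      exact Set.indicator_of_notMem hx _
    have herr : StokesFE.normL2 (StokesFE.tri K)
        ((∑ K' ∈ T, StokesFE.restr K' (StokesFE.divPoly (P K'))) - ∑ K' ∈ T, pK K') =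
        StokesFE.normL2 (StokesFE.tri K) (StokesFE.evalAt (StokesFE.divPoly (P K - R))) := by
      rw [StokesFE.normL2, StokesFE.normL2]
      congr 1
      refine integral_congr_ae ?_
      filter_upwards [hT.sum_ae_eq hzero hK, hT.sum_ae_eq
        (r := fun K' => StokesFE.restr K' (StokesFE.divPoly (P K')))
        (fun _ _ _ hx => Set.indicator_of_notMem hx _) hK,
        StokesFE.restr_ae_eq K (StokesFE.divPoly (P K)),
        StokesFE.restr_ae_eq K (StokesFE.divPoly R)] with x h1 h2 h3 h4
      rw [Pi.sub_apply, h1, h2, hRK, h3, h4, map_sub, StokesFE.evalAt_sub]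
    rw [herr]
    exact StokesFE.normL2_le hΩ hT hK h (by positivity)
      (fun D hD => h.gradient_le hCle hκ hD) hst
      (StokesFE.velocitySpace_memH1 huh.1) (hP K hK) hR hz hzc hRl
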